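/- Consider the structural causal model $$Y = f(X^\top\beta^0 + U^\top\delta^0)+\varepsilon,\qquad X=\Gamma^\top U+Z,$$ with $X,Z,\beta^0\in\mathbb{R}^p$, $U,\delta^0\in\mathbb{R}^q$, $q\ge 1$, $\Gamma\in\mathbb{R}^{q\times p}$, where $f:\mathbb{R}\to\mathbb{R}$ is strictly increasing and continuously differentiable with bounded derivative, $\mathbb{E}(\varepsilon\mid X,U)=0$, and $Z$ is mean-zero and independent of $U$. Let $(Y_i,X_i,U_i,Z_i,\varepsilon_i)_{i=1}^n$, $n\ge1$, be i.i.d. copies of $(Y,X,U,Z,\varepsilon)$. Write $S=\{j:\beta^0_j\ne0\}$, $s=|S|$, $r_\ell=\lambda_{\min}(\Gamma\Gamma^\top)$ and assume $r_\ell>0$. Let $C(S)=\{\Delta\in\mathbb{R}^p:\|\Delta_{S^c}\|_1\le 3\|\Delta_S\|_1\}$ and, for $\tau,\kappa,c_p>0$, let $\Omega(\tau,\kappa,c_p)$ be the event that for all $\Delta_1\in C(S)$ and $\Delta_2\in\mathbb{R}^p$, $$\frac1n\sum_{i=1}^n\bigl(X_i^\top(\Delta_1+\Delta_2)\bigr)^2\,\mathbf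 1_{\{|X_i^\top\beta^0+U_i^\top\delta^0|\le\tau\}}\ \ge\ \kappa\|\Delta_1\|_2^2-c_p\,r_\ell\sqrt{\frac{\log p}{n}}\,\|\Delta_2\|_2^2 .$$ Let positive constants $c_z,\sigma_z,\sigma_u,\sigma_\varepsilon,\sigma_x,\sigma_\eta$, constants $C_\delta,C,C'$, a sequence $a_n\to0$ and $m\in\mathbb{N}$ be given. Then there exist constants $\kappa,c_p,\tau,c>0$, depending only on these, such that the following holds. Suppose that 1. $\lambda_{\min}(\mathbb{E}(ZZ^\top))\ge c_z$; 2. $U$, $Z$, $\varepsilon$ and $X_1,\dots,X_p$ are mean-zero and, for all unit vectors $u\in\mathbb{R}^p$, $v\in\mathbb{R}^q$, all $t\in\mathbb{R}$ and all $j\in\{1,\dots,p\}$, $\mathbb{E}e^{tZ^\top u}\le e^{t^2\sigma_z^2/2}$, $\mathbb{E}e^{tU^\top v}\le e^{t^2\sigma_u^2/2}$, $\mathbb{E}(e^{t\varepsilon}\mid X,U)\le e^{t^2\sigma_\varepsilon^2/2}$ almost surely, $\mathbb{E}e^{tX_j}\le e^{t^2\sigma_x^2/2}$ and $\mathbb{E}e^{t(X^\top\beta^0+U^\top\delta^0)}\le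 e^{t^2\sigma_\eta^2/2}$; moreover $\mathrm{Var}(U)=I$ and $\|\delta^0\|_2\le C_\delta$; 3. $s\sqrt{\log p/n}\le a_n$ and $\dfrac{sp}{r_\ell}\sqrt{\dfrac{\log p}{n}}\le C$; 4. $n\le C'p$. Then $$\mathbb{P}(\Omega(\tau,\kappa,c_p))\ \ge\ 1-c\,(n^{-m}+p^{-m}).$$ -/

import Mathlib

open MeasureTheory ProbabilityTheory Filter Topology
open scoped NNReal Matrix

noncomputable section

/-- The smallest eigenvalue of a (real symmetric) matrix. -/
def lambdaMin {d : ℕ} (A : Matrix (Fin d) (Fin d) ℝ) : ℝ := sInf (spectrum ℝ A)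

/-- The Euclidean norm of a coordinate vector. -/
def l2norm {d : ℕ} (v : Fin d → ℝ) : ℝ := ‖(WithLp.toLp 2 v : EuclideanSpace ℝ (Fin d))‖

/-- The deterministic parameters of the structural causal model: link function `f`,
loading matrix `Γ`, sparse causal effect `β`, confounding effect `δ`. -/
structure Params (p q : ℕ) where
  f : ℝ → ℝ
  Γ : Matrix (Fin q) (Fin p) ℝ
  β : Fin p → ℝ
  δ : Fin q → ℝ

namespace Params

variable {p q : ℕ} (θ : Params p q)

open Classical in
/-- The support `S` of `β`. -/
def S : Finset (Fin p) := Finset.univ.filter (fun j => θ.β j ≠ 0)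

/-- The sparsity level `s = |S|`. -/
def s : ℕ := θ.S.card

/-- The confounding strength `r_ℓ = λ_min(Γ Γᵀ)`. -/
def rl : ℝ := lambdaMin (θ.Γ * θ.Γᵀ)

/-- The linear predictor `xᵀ β + uᵀ δ`. -/
def eta (x : Fin p → ℝ) (u : Fin q → ℝ) : ℝ := x ⬝ᵥ θ.β + u ⬝ᵥ θ.δ

end Params

/-- A tuple of random variables `(Y, X, U, Z, ε)`: response, treatment vector, latent
confounders, error of the `X`-model, error of the `Y`-model. -/
structure RandVars (Ω : Type*) (p q : ℕ) where
  Y : Ω → ℝ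
  X : Ω → Fin p → ℝ
  U : Ω → Fin q → ℝ
  Z : Ω → Fin p → ℝ
  ε : Ω → ℝ

namespace RandVars

variable {Ω : Type*} {p q : ℕ} (V : RandVars Ω p q)

/-- All the random variables as one random element. -/
def joint (ω : Ω) : ℝ × (Fin p → ℝ) × (Fin q → ℝ) × (Fin p → ℝ) × ℝ :=
  (V.Y ω, V.X ω, V.U ω, V.Z ω, V.ε ω)

/-- The sigma-algebra generated by `(X, U)`. -/
abbrev sigmaXU : MeasurableSpace Ω :=
  MeasurableSpace.comap (fun ω => (V.X ω, V.U ω)) inferInstance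

/-- The matrix `E[Z Zᵀ]`. -/
def secondMomentZ [MeasurableSpace Ω] (P : Measure Ω) : Matrix (Fin p) (Fin p) ℝ :=
  Matrix.of fun j k => ∫ ω, V.Z ω j * V.Z ω k ∂P

/-- The covariance matrix `Var(U)`. -/
def varU [MeasurableSpace Ω] (P : Measure Ω) : Matrix (Fin q) (Fin q) ℝ :=
  Matrix.of fun k l => covariance (fun ω => V.U ω k) (fun ω => V.U ω l) P

end RandVars

/-- The structural causal model
`Y = f(Xᵀ β + Uᵀ δ) + ε`, `X = Γᵀ U + Z`, with `f` strictly increasing and continuously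
differentiable with bounded derivative, `E(ε | X, U) = 0`, and `Z` mean zero and
independent of `U`. -/
structure IsConfoundedModel {Ω : Type*} [MeasurableSpace Ω] {p q : ℕ}
    (θ : Params p q) (V : RandVars Ω p q) (P : Measure Ω) : Prop where
  strictMono_f : StrictMono θ.f
  contDiff_f : ContDiff ℝ 1 θ.f
  bounded_deriv_f : ∃ K : ℝ, ∀ t, |deriv θ.f t| ≤ K
  measurable_U : Measurable V.U
  measurable_Z : Measurable V.Z
  measurable_ε : Measurable V.ε
  X_eq : ∀ ω, V.X ω = θ.Γᵀ *ᵥ V.U ω + V.Z ω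
  Y_eq : ∀ ω, V.Y ω = θ.f (θ.eta (V.X ω) (V.U ω)) + V.ε ω
  integrable_ε : Integrable V.ε P
  condExp_ε : condExp V.sigmaXU P V.ε =ᵐ[P] 0
  integrable_Z : ∀ j, Integrable (fun ω => V.Z ω j) P
  mean_Z : ∀ j, ∫ ω, V.Z ω j ∂P = 0
  indep_Z_U : IndepFun V.Z V.U P

/-- The sub-Gaussianity conditions, with variance proxies `σz², σu², σε², σx², ση²`, the
normalisation `Var(U) = I`, and the bound `‖δ‖₂ ≤ Cδ`. -/
structure SubGaussianAssumption {Ω : Type*} [MeasurableSpace Ω] {p q : ℕ}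
    (σz σu σε σx ση : ℝ≥0) (Cδ : ℝ)
    (θ : Params p q) (V : RandVars Ω p q) (P : Measure Ω) : Prop where
  mean_U : ∀ k, ∫ ω, V.U ω k ∂P = 0
  subG_Z : ∀ u : Fin p → ℝ, l2norm u = 1 →
    HasSubgaussianMGF (fun ω => V.Z ω ⬝ᵥ u) (σz ^ 2) P
  subG_U : ∀ v : Fin q → ℝ, l2norm v = 1 →
    HasSubgaussianMGF (fun ω => V.U ω ⬝ᵥ v) (σu ^ 2) P
  integrable_exp_ε : ∀ t : ℝ, Integrable (fun ω => Real.exp (t * V.ε ω)) P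
  subG_ε : ∀ t : ℝ, ∀ᵐ ω ∂P,
    condExp V.sigmaXU P (fun ω' => Real.exp (t * V.ε ω')) ω
      ≤ Real.exp (t ^ 2 * (σε : ℝ) ^ 2 / 2)
  subG_X : ∀ j : Fin p, HasSubgaussianMGF (fun ω => V.X ω j) (σx ^ 2) P
  subG_eta : HasSubgaussianMGF (fun ω => θ.eta (V.X ω) (V.U ω)) (ση ^ 2) P
  var_U : V.varU P = 1
  norm_δ : l2norm θ.δ ≤ Cδ

/-- The sample `V 0, …, V (n-1)` consists of independent copies of the population
tuple `V₀`. -/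
structure IsIIDSample {Ω₀ Ω : Type*} [MeasurableSpace Ω₀] [MeasurableSpace Ω] {n p q : ℕ}
    (V₀ : RandVars Ω₀ p q) (P₀ : Measure Ω₀)
    (V : Fin n → RandVars Ω p q) (P : Measure Ω) : Prop where
  indep : iIndepFun (fun i => (V i).joint) P
  identDistrib : ∀ i, IdentDistrib (V i).joint V₀.joint P P₀

/-- The cone `C(S) = {Δ : ‖Δ_{Sᶜ}‖₁ ≤ 3 ‖Δ_S‖₁}`. -/
def cone {p : ℕ} (S : Finset (Fin p)) : Set (Fin p → ℝ) :=
  {Δ | ∑ j ∈ Sᶜ, |Δ j| ≤ 3 * ∑ j ∈ S, |Δ j|}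

/-- The event `Ω(τ, κ, c_p)` that the truncated, confounding-adjusted restricted
eigenvalue condition holds. -/
def goodEvent {Ω : Type*} {n p q : ℕ} (θ : Params p q) (V : Fin n → RandVars Ω p q)
    (τ κ cp : ℝ) : Set Ω :=
  {ω | ∀ Δ₁ ∈ cone θ.S, ∀ Δ₂ : Fin p → ℝ,
    κ * l2norm Δ₁ ^ 2 - cp * θ.rl * √(Real.log p / n) * l2norm Δ₂ ^ 2 ≤
      (1 / (n : ℝ)) * ∑ i, ((V i).X ω ⬝ᵥ (Δ₁ + Δ₂)) ^ 2 *
        Set.indicator {ω' | |θ.eta ((V i).X ω') ((V i).U ω')| ≤ τ} (fun _ => (1 : ℝ)) ω}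

end

/-! Since `X = Γᵀ U + Z`, the form `Xᵀ Δ` equals `Uᵀ w + Zᵀ Δ` with `w = Γ Δ`. The proof forgets
this relation and bounds the truncated form from below for every `w ∈ ℝ^q` and every `Δ` in the
cone. In population this is easy: `U` is isotropic and uncorrelated with `Z`, so the second moment
is at least `min 1 cz * (‖w‖² + ‖Δ‖²)` (`SubGaussianAssumption.le_integral_sq`), and truncation at a
large `τ` costs at most half of it (`le_integral_sq_mul_bandIndicator`).

Concentration is handled blockwise. The `UU` block is uniform over the unit ball of `ℝ^q` by a net.
The `UZ` and `ZZ` blocks are controlled entrywise at level `√(log p / n)`, which suffices because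
cone vectors have `ℓ¹` norm at most `4 √s ‖Δ‖₂`. These steps need `q s log p / n` small. Comparing
the trace of `Γ Γᵀ` with the variances of the `X_j` gives `q r_ℓ ≤ 8 σx² p`
(`SubGaussianAssumption.card_mul_rl_le`), so the second part of condition 3 bounds `q s √(log p /
n)`; another factor `√(log p / n)` makes it small.

For a perturbation `Δ₂`, the part `Γ Δ₂` is absorbed in the free vector `w`, leaving only `Zᵀ Δ₂`.
Its untruncated empirical second moment is `O(1 + p/n) ‖Δ₂‖²`. As `n ≤ C' p` and `s ≥ 1`, this is at
most a multiple of `(p/n) log p = p (√(log p / n))²`, hence of `r_ℓ √(log p / n)` by condition 3.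
The case `s = 0`, where the cone is trivial, is treated separately. -/

/-- `A` has a squared-exponential moment at rate `l` which is at most `2`. -/
structure SqExpBound {𝒯 : Type*} [MeasurableSpace 𝒯] (l : ℝ) (A : 𝒯 → ℝ) (ν : Measure 𝒯) :
    Prop where
  measurable : Measurable A
  integrable : Integrable (fun t => Real.exp (l * A t ^ 2)) ν
  integral_le : ∫ t, Real.exp (l * A t ^ 2) ∂ν ≤ 2

/-! ### Squared-exponential moments and sub-exponential generating functions. -/

section Tools

variable {𝒯 : Type*} [MeasurableSpace 𝒯] {ν : Measure 𝒯}

/-- At `a = 1/4` the Gaussian integral is exactly `√2`. This is the source of the requirement `l * c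
≤ 1 / 4` below. -/
lemma lintegral_exp_sq_gaussian_le {a : ℝ} (ha : a ≤ 1 / 4) :
    ∫⁻ g, ENNReal.ofReal (Real.exp (a * g ^ 2)) ∂(gaussianReal 0 1) ≤ ENNReal.ofReal 2 := by
  have hg : ∀ g : ℝ, gaussianPDFReal 0 1 g * Real.exp (1 / 4 * g ^ 2)
      = (√(2 * Real.pi))⁻¹ * Real.exp (-(1 / 4) * g ^ 2) := by
    intro g
    rw [gaussianPDFReal_def]
    simp only [NNReal.coe_one, mul_one, sub_zero]
    rw [mul_assoc, ← Real.exp_add]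
    ring_nf
  calc ∫⁻ g, ENNReal.ofReal (Real.exp (a * g ^ 2)) ∂(gaussianReal 0 1)
      ≤ ∫⁻ g, ENNReal.ofReal (Real.exp (1 / 4 * g ^ 2)) ∂(gaussianReal 0 1) := by
        refine lintegral_mono fun g => ENNReal.ofReal_le_ofReal (Real.exp_le_exp.2 ?_)
        exact mul_le_mul_of_nonneg_right ha (sq_nonneg g)
    _ = ∫⁻ g, ENNReal.ofReal ((√(2 * Real.pi))⁻¹ * Real.exp (-(1 / 4) * g ^ 2)) := by
        rw [gaussianReal_of_var_ne_zero _ one_ne_zero,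
          lintegral_withDensity_eq_lintegral_mul _ (measurable_gaussianPDF _ _) (by fun_prop)]
        refine lintegral_congr fun g => ?_
        rw [Pi.mul_apply, gaussianPDF, ← ENNReal.ofReal_mul (gaussianPDFReal_nonneg _ _ _), hg]
    _ = ENNReal.ofReal ((√(2 * Real.pi))⁻¹ * √(Real.pi / (1 / 4))) := by
        rw [← ofReal_integral_eq_lintegral_ofReal]
        · rw [integral_const_mul, integral_gaussian]
        · exact (integrable_exp_neg_mul_sq (by norm_num)).const_mul _
        · exact Eventually.of_forall fun g => by positivity
    _ ≤ ENNReal.ofReal 2 := by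
        refine ENNReal.ofReal_le_ofReal ?_
        have h2 : √(Real.pi / (1 / 4)) = √2 * √(2 * Real.pi) := by
          rw [← Real.sqrt_mul (by norm_num)]; congr 1; ring
        have hpos : 0 < √(2 * Real.pi) := Real.sqrt_pos.2 (by positivity)
        rw [h2, mul_comm, mul_assoc, mul_inv_cancel₀ hpos.ne', mul_one]
        rw [Real.sqrt_le_left (by norm_num)]; norm_num

/-- The Gaussian generating function read backwards: an auxiliary Gaussian linearises the square, so
that bounds on `E exp(t A)` apply under Fubini. -/
lemma exp_sq_eq_lintegral_gaussian {l : ℝ} (hl : 0 ≤ l) (x : ℝ) :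
    ENNReal.ofReal (Real.exp (l * x ^ 2))
      = ∫⁻ g, ENNReal.ofReal (Real.exp (√(2 * l) * g * x)) ∂(gaussianReal 0 1) := by
  have h := congrFun (mgf_fun_id_gaussianReal (μ := 0) (v := 1)) (√(2 * l) * x)
  have hi : Integrable (fun g : ℝ => Real.exp (√(2 * l) * g * x)) (gaussianReal 0 1) := by
    have := integrable_exp_mul_gaussianReal (μ := 0) (v := 1) (√(2 * l) * x)
    refine this.congr (Eventually.of_forall fun g => ?_)
    simp only; congr 1; ring
  rw [← ofReal_integral_eq_lintegral_ofReal hi (Eventually.of_forall fun g => by positivity)]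
  congr 1
  rw [mgf] at h
  have e : (fun g : ℝ => Real.exp (√(2 * l) * g * x))
      = fun g : ℝ => Real.exp (√(2 * l) * x * g) := by
    funext g; congr 1; ring
  rw [e, h, mul_pow, Real.sq_sqrt (by positivity)]
  simp only [NNReal.coe_one]
  congr 1; ring

lemma SqExpBound.of_hasSubgaussianMGF [IsProbabilityMeasure ν] {A : 𝒯 → ℝ} (hA : Measurable A)
    {c : ℝ≥0} (h : HasSubgaussianMGF A c ν) {l : ℝ} (hl : 0 ≤ l) (hlc : l * c ≤ 1 / 4) :
    SqExpBound l A ν := by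
  have key : ∫⁻ t, ENNReal.ofReal (Real.exp (l * A t ^ 2)) ∂ν ≤ ENNReal.ofReal 2 := by
    calc ∫⁻ t, ENNReal.ofReal (Real.exp (l * A t ^ 2)) ∂ν
        = ∫⁻ t, ∫⁻ g, ENNReal.ofReal (Real.exp (√(2 * l) * g * A t)) ∂(gaussianReal 0 1) ∂ν :=
          lintegral_congr fun t => exp_sq_eq_lintegral_gaussian hl _
      _ = ∫⁻ g, ∫⁻ t, ENNReal.ofReal (Real.exp (√(2 * l) * g * A t)) ∂ν ∂(gaussianReal 0 1) := by
          rw [lintegral_lintegral_swap]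
          exact Measurable.aemeasurable (by fun_prop)
      _ ≤ ∫⁻ g, ENNReal.ofReal (Real.exp (l * c * g ^ 2)) ∂(gaussianReal 0 1) := by
          refine lintegral_mono fun g => ?_
          rw [← ofReal_integral_eq_lintegral_ofReal (h.integrable_exp_mul _)
            (Eventually.of_forall fun g => by positivity)]
          refine ENNReal.ofReal_le_ofReal ((h.mgf_le _).trans (le_of_eq ?_))
          rw [mul_pow, Real.sq_sqrt (by positivity)]
          congr 1; ring
      _ ≤ _ := lintegral_exp_sq_gaussian_le hlc
  have hm : AEStronglyMeasurable (fun t => Real.exp (l * A t ^ 2)) ν :=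
    Measurable.aestronglyMeasurable (by fun_prop)
  have hi : Integrable (fun t => Real.exp (l * A t ^ 2)) ν := by
    refine ⟨hm, ?_⟩
    rw [hasFiniteIntegral_iff_ofReal (Eventually.of_forall fun g => by positivity)]
    exact key.trans_lt ENNReal.ofReal_lt_top
  refine ⟨hA, hi, ?_⟩
  rw [← ofReal_integral_eq_lintegral_ofReal hi
    (Eventually.of_forall fun g => by positivity)] at key
  exact (ENNReal.ofReal_le_ofReal_iff (by norm_num)).1 key

lemma SqExpBound.of_le {l l' : ℝ} {A A' : 𝒯 → ℝ} (h : SqExpBound l A ν) (hA' : Measurable A')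
    (hle : ∀ t, l' * A' t ^ 2 ≤ l * A t ^ 2) : SqExpBound l' A' ν := by
  have hle' : ∀ t, Real.exp (l' * A' t ^ 2) ≤ Real.exp (l * A t ^ 2) :=
    fun t => Real.exp_le_exp.2 (hle t)
  have hi : Integrable (fun t => Real.exp (l' * A' t ^ 2)) ν := by
    refine h.integrable.mono' (Measurable.aestronglyMeasurable (by fun_prop))
      (Eventually.of_forall fun t => ?_)
    rw [Real.norm_eq_abs, abs_of_pos (Real.exp_pos _)]
    exact hle' t
  exact ⟨hA', hi, (integral_mono hi h.integrable hle').trans h.integral_le⟩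

/-- By `|A B| ≤ (A² + B²) / 2` and convexity of `exp`, neither the rate `l` nor the bound `2`
deteriorates. The factor `b` is the truncation indicator, or `1`. -/
lemma SqExpBound.mul {l : ℝ} (hl : 0 ≤ l) {A B b : 𝒯 → ℝ} (hA : SqExpBound l A ν)
    (hB : SqExpBound l B ν) (hb : Measurable b) (hb1 : ∀ t, |b t| ≤ 1) :
    Integrable (fun t => Real.exp (l * |A t * B t * b t|)) ν ∧
      ∫ t, Real.exp (l * |A t * B t * b t|) ∂ν ≤ 2 := by
  have hA' := hA.measurable
  have hB' := hB.measurable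
  have hle : ∀ t, Real.exp (l * |A t * B t * b t|)
      ≤ (1 / 2) * Real.exp (l * A t ^ 2) + (1 / 2) * Real.exp (l * B t ^ 2) := by
    intro t
    have h1 : |A t * B t * b t| ≤ (A t ^ 2 + B t ^ 2) / 2 := by
      rw [abs_mul, abs_mul]
      have := two_mul_le_add_sq |A t| |B t|
      rw [sq_abs, sq_abs] at this
      have h0 : 0 ≤ |A t| * |B t| := by positivity
      nlinarith [hb1 t, abs_nonneg (b t), mul_le_mul_of_nonneg_left (hb1 t) h0]
    have h2 : l * |A t * B t * b t| ≤ (1 / 2) * (l * A t ^ 2) + (1 / 2) * (l * B t ^ 2) := by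
      nlinarith [mul_le_mul_of_nonneg_left h1 hl]
    refine (Real.exp_le_exp.2 h2).trans ?_
    exact convexOn_exp.2 (Set.mem_univ _) (Set.mem_univ _) (by norm_num) (by norm_num)
      (by norm_num)
  have hs : Integrable (fun t => (1 / 2) * Real.exp (l * A t ^ 2)
      + (1 / 2) * Real.exp (l * B t ^ 2)) ν :=
    (hA.integrable.const_mul _).add (hB.integrable.const_mul _)
  have hi : Integrable (fun t => Real.exp (l * |A t * B t * b t|)) ν := by
    refine hs.mono' ?_ (Eventually.of_forall fun t => ?_)
    · have hm : Measurable (fun t => A t * B t * b t) := by fun_prop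
      have hm' : Measurable fun t => |A t * B t * b t| := by
        simpa [Real.norm_eq_abs] using hm.norm
      exact (Measurable.aestronglyMeasurable (by fun_prop))
    · rw [Real.norm_eq_abs, abs_of_pos (Real.exp_pos _)]
      exact hle t
  refine ⟨hi, (integral_mono hi hs hle).trans ?_⟩
  rw [integral_add (hA.integrable.const_mul _) (hB.integrable.const_mul _),
    integral_const_mul, integral_const_mul]
  linarith [hA.integral_le, hB.integral_le]

lemma sq_le_two_mul_exp {y : ℝ} (hy : 0 ≤ y) : y ^ 2 ≤ 2 * Real.exp y := by
  nlinarith [Real.quadratic_le_exp_of_nonneg hy]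

lemma exp_le_one_add_sq_mul_exp_abs (x : ℝ) : Real.exp x ≤ 1 + x + x ^ 2 * Real.exp |x| := by
  have h := Complex.norm_exp_sub_sum_le_norm_mul_exp (x : ℂ) 2
  have e : Complex.exp (x : ℂ) - ∑ m ∈ Finset.range 2, (x : ℂ) ^ m / (m.factorial : ℂ)
      = ((Real.exp x - (1 + x) : ℝ) : ℂ) := by
    simp [Finset.sum_range_succ]
  rw [e, Complex.norm_real, Complex.norm_real, Real.norm_eq_abs, Real.norm_eq_abs, sq_abs] at h
  linarith [le_abs_self (Real.exp x - (1 + x))]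

lemma integrable_of_exp_abs {l : ℝ} (hl : 0 < l) {W : 𝒯 → ℝ} (hW : Measurable W)
    (hi : Integrable (fun t => Real.exp (l * |W t|)) ν) : Integrable W ν := by
  refine (hi.const_mul (1 / l)).mono' hW.aestronglyMeasurable (Eventually.of_forall fun t => ?_)
  rw [Real.norm_eq_abs, one_div, ← div_eq_inv_mul, le_div_iff₀ hl]
  linarith [Real.add_one_le_exp (l * |W t|)]

/-- The moment generating function of a sub-exponential variable. -/
lemma mgf_le_of_exp_abs [IsProbabilityMeasure ν] {l : ℝ} (hl : 0 < l) {W : 𝒯 → ℝ}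
    (hW : Measurable W) (hi : Integrable (fun t => Real.exp (l * |W t|)) ν)
    (hK : ∫ t, Real.exp (l * |W t|) ∂ν ≤ 2) {r : ℝ} (hr : |r| ≤ l / 2) :
    Integrable (fun t => Real.exp (r * W t)) ν ∧
      mgf W ν r ≤ Real.exp (r * ∫ t, W t ∂ν + 16 * r ^ 2 / l ^ 2) := by
  have hWi := integrable_of_exp_abs hl hW hi
  have hle : ∀ t, Real.exp (r * W t) ≤ 1 + r * W t + 8 * r ^ 2 / l ^ 2 * Real.exp (l * |W t|) := by
    intro t
    refine (exp_le_one_add_sq_mul_exp_abs _).trans ?_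
    -- The rate `l` is split in two: one half dominates `exp |r W|`, the other absorbs `W²` through
    -- `y² ≤ 2 exp y` at `y = l |W| / 2`, whence the factor `8 / l²`.
    have h1 : |r * W t| ≤ l / 2 * |W t| := by
      rw [abs_mul]; exact mul_le_mul_of_nonneg_right hr (abs_nonneg _)
    have h2 := sq_le_two_mul_exp (y := l / 2 * |W t|) (by positivity)
    have h3 : (r * W t) ^ 2 * Real.exp |r * W t|
        ≤ (r * W t) ^ 2 * Real.exp (l / 2 * |W t|) :=
      mul_le_mul_of_nonneg_left (Real.exp_le_exp.2 h1) (sq_nonneg _)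
    have h4 : (r * W t) ^ 2 ≤ 8 * r ^ 2 / l ^ 2 * Real.exp (l / 2 * |W t|) := by
      rw [mul_pow, sq_abs] at h2
      have : W t ^ 2 ≤ 8 / l ^ 2 * Real.exp (l / 2 * |W t|) := by
        rw [div_mul_eq_mul_div, le_div_iff₀ (by positivity)]
        nlinarith
      calc (r * W t) ^ 2 = r ^ 2 * W t ^ 2 := by ring
        _ ≤ r ^ 2 * (8 / l ^ 2 * Real.exp (l / 2 * |W t|)) :=
            mul_le_mul_of_nonneg_left this (sq_nonneg _)
        _ = _ := by ring
    have h5 : Real.exp (l * |W t|) = Real.exp (l / 2 * |W t|) * Real.exp (l / 2 * |W t|) := by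
      rw [← Real.exp_add]; ring_nf
    have h6 := mul_le_mul_of_nonneg_right h4 (Real.exp_pos (l / 2 * |W t|)).le
    rw [h5]
    linarith
  have hlin : Integrable (fun t => 1 + r * W t) ν := (integrable_const _).add (hWi.const_mul _)
  have hs : Integrable
      (fun t => 1 + r * W t + 8 * r ^ 2 / l ^ 2 * Real.exp (l * |W t|)) ν :=
    hlin.add (hi.const_mul _)
  have hint : Integrable (fun t => Real.exp (r * W t)) ν := by
    refine hs.mono' (Measurable.aestronglyMeasurable (by fun_prop))
      (Eventually.of_forall fun t => ?_)
    rw [Real.norm_eq_abs, abs_of_pos (Real.exp_pos _)]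
    exact hle t
  refine ⟨hint, (integral_mono hint hs hle).trans ?_⟩
  rw [integral_add hlin (hi.const_mul _),
    integral_add (integrable_const _) (hWi.const_mul _), integral_const_mul, integral_const_mul]
  simp only [integral_const, probReal_univ, smul_eq_mul, mul_one]
  have h8 : 8 * r ^ 2 / l ^ 2 * ∫ t, Real.exp (l * |W t|) ∂ν ≤ 16 * r ^ 2 / l ^ 2 := by
    have := mul_le_mul_of_nonneg_left hK (show 0 ≤ 8 * r ^ 2 / l ^ 2 by positivity)
    calc _ ≤ _ := this
      _ = _ := by ring
  have := Real.add_one_le_exp (r * ∫ t, W t ∂ν + 16 * r ^ 2 / l ^ 2)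
  linarith

end Tools

/-! ### Exponential concentration of empirical means. -/

/-- Deviation of the empirical mean of `f` over the sample `T` from its expectation. -/
noncomputable def dev {Ω 𝒯 : Type*} [MeasurableSpace 𝒯] {n : ℕ} (T : Fin n → Ω → 𝒯) (ν : Measure 𝒯)
    (f : 𝒯 → ℝ) (ω : Ω) : ℝ :=
  (1 / (n : ℝ)) * ∑ i, f (T i ω) - ∫ t, f t ∂ν

section Deviation

variable {Ω 𝒯 : Type*} [MeasurableSpace 𝒯] {ν : Measure 𝒯} {n : ℕ} {T : Fin n → Ω → 𝒯}

lemma dev_sum {ι : Type*} (s : Finset ι) (F : ι → 𝒯 → ℝ) (hF : ∀ i ∈ s, Integrable (F i) ν)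
    (ω : Ω) : dev T ν (fun t => ∑ i ∈ s, F i t) ω = ∑ i ∈ s, dev T ν (F i) ω := by
  simp only [dev]
  rw [integral_finsetSum _ hF, Finset.sum_sub_distrib, ← Finset.mul_sum, Finset.sum_comm]

lemma dev_const_mul (c : ℝ) (F : 𝒯 → ℝ) (ω : Ω) :
    dev T ν (fun t => c * F t) ω = c * dev T ν F ω := by
  simp only [dev, integral_const_mul, ← Finset.mul_sum]
  ring

end Deviation

section Concentration

variable {Ω 𝒯 : Type*} [MeasurableSpace Ω] [MeasurableSpace 𝒯] {P : Measure Ω}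
  [IsProbabilityMeasure P] {ν : Measure 𝒯} [IsProbabilityMeasure ν] {n : ℕ} {T : Fin n → Ω → 𝒯}

/-- Chernoff's bound with `r` left free: small deviations call for `r` proportional to `x`, large
ones for the extreme value `l / 2`. -/
lemma measure_dev_ge_le (hn : 1 ≤ n) (hind : iIndepFun T P)
    (hid : ∀ i, IdentDistrib (T i) id P ν) {l : ℝ} (hl : 0 < l) {W : 𝒯 → ℝ}
    (hW : Measurable W) (hi : Integrable (fun t => Real.exp (l * |W t|)) ν)
    (hK : ∫ t, Real.exp (l * |W t|) ∂ν ≤ 2) {r : ℝ} (hr0 : 0 ≤ r) (hr : r ≤ l / 2) (x : ℝ) :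
    P.real {ω | x ≤ dev T ν W ω} ≤ Real.exp (n * (16 * r ^ 2 / l ^ 2 - r * x)) := by
  obtain ⟨hint, hmgf⟩ := mgf_le_of_exp_abs hl hW hi hK (r := r) (by rwa [abs_of_nonneg hr0])
  have hn' : (0 : ℝ) < n := by exact_mod_cast hn
  have hindW : iIndepFun (fun i => W ∘ T i) P := hind.comp _ fun _ => hW
  have hidW : ∀ i, IdentDistrib (W ∘ T i) W P ν := fun i => (hid i).comp hW
  have hsum : mgf (∑ i, W ∘ T i) P r = mgf W ν r ^ n := by
    rw [hindW.mgf_sum₀ (fun i => (hidW i).aemeasurable_fst)]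
    simp [fun i => mgf_congr_of_identDistrib _ _ (hidW i) r]
  have hpos : 0 < mgf W ν r := mgf_pos hint
  have hint' : Integrable (fun ω => Real.exp (r * (∑ i, W ∘ T i) ω)) P := by
    -- A non-integrable exponential would have `mgf` equal to `0` by convention, but the product of
    -- the individual ones is positive.
    by_contra hcon
    have h0 := mgf_undef hcon
    rw [hsum] at h0
    exact (pow_pos hpos n).ne' h0
  have hset : {ω | x ≤ dev T ν W ω}
      = {ω | n * (x + ∫ t, W t ∂ν) ≤ (∑ i, W ∘ T i) ω} := by
    ext ω
    simp only [Set.mem_ofPred_eq, dev, Finset.sum_apply, Function.comp]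
    rw [le_sub_iff_add_le, one_div, ← div_eq_inv_mul, le_div_iff₀ hn', mul_comm]
  rw [hset]
  refine (measure_ge_le_exp_mul_mgf _ hr0 hint').trans ?_
  rw [hsum]
  calc _ ≤ Real.exp (-r * (n * (x + ∫ t, W t ∂ν)))
        * Real.exp (r * ∫ t, W t ∂ν + 16 * r ^ 2 / l ^ 2) ^ n := by gcongr
    _ = _ := by
      rw [← Real.exp_nat_mul, ← Real.exp_add]
      congr 1; ring

lemma measure_abs_dev_ge_le (hn : 1 ≤ n) (hind : iIndepFun T P)
    (hid : ∀ i, IdentDistrib (T i) id P ν) {l : ℝ} (hl : 0 < l) {W : 𝒯 → ℝ}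
    (hW : Measurable W) (hi : Integrable (fun t => Real.exp (l * |W t|)) ν)
    (hK : ∫ t, Real.exp (l * |W t|) ∂ν ≤ 2) {r : ℝ} (hr0 : 0 ≤ r) (hr : r ≤ l / 2) (x : ℝ) :
    P.real {ω | x ≤ |dev T ν W ω|} ≤ 2 * Real.exp (n * (16 * r ^ 2 / l ^ 2 - r * x)) := by
  have h1 := measure_dev_ge_le hn hind hid hl hW hi hK hr0 hr x
  have h2 := measure_dev_ge_le hn hind hid hl hW.neg (W := fun t => -W t) (by simpa using hi)
    (by simpa using hK) hr0 hr x
  have hneg : ∀ ω, dev T ν (fun t => -W t) ω = -dev T ν W ω := by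
    intro ω
    simp only [dev, Finset.sum_neg_distrib, integral_neg]
    ring
  have hsub : {ω | x ≤ |dev T ν W ω|}
      ⊆ {ω | x ≤ dev T ν W ω} ∪ {ω | x ≤ dev T ν (fun t => -W t) ω} := by
    intro ω hω
    simp only [Set.mem_ofPred_eq, Set.mem_union, hneg] at hω ⊢
    exact le_abs.1 hω
  calc _ ≤ _ := measureReal_mono hsub
    _ ≤ _ := measureReal_union_le _ _
    _ ≤ _ := by linarith

end Concentration
-- Euclidean norms and nets of the unit ball.
section EuclideanNorm

variable {d : ℕ}

lemma l2norm_nonneg (v : Fin d → ℝ) : 0 ≤ l2norm v := norm_nonneg _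

lemma l2norm_sq (v : Fin d → ℝ) : l2norm v ^ 2 = ∑ i, v i ^ 2 := by
  simp [l2norm, EuclideanSpace.norm_sq_eq]

lemma l2norm_sq_eq_dotProduct (v : Fin d → ℝ) : l2norm v ^ 2 = v ⬝ᵥ v := by
  rw [l2norm_sq]; simp [dotProduct, sq]

lemma l2norm_smul (c : ℝ) (v : Fin d → ℝ) : l2norm (c • v) = |c| * l2norm v := by
  simp [l2norm, WithLp.toLp_smul, norm_smul]

lemma abs_dotProduct_le (v w : Fin d → ℝ) : |v ⬝ᵥ w| ≤ l2norm v * l2norm w := by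
  apply abs_le_of_sq_le_sq _ (mul_nonneg (l2norm_nonneg _) (l2norm_nonneg _))
  rw [mul_pow, l2norm_sq, l2norm_sq]
  exact Finset.sum_mul_sq_le_sq_mul_sq _ _ _

lemma l2norm_single (j : Fin d) : l2norm (Pi.single j (1 : ℝ)) = 1 := by
  have : l2norm (Pi.single j (1 : ℝ)) ^ 2 = 1 := by
    rw [l2norm_sq_eq_dotProduct]; simp
  nlinarith [l2norm_nonneg (Pi.single j (1 : ℝ))]

lemma sum_abs_le_sqrt_card_mul_l2norm (s : Finset (Fin d)) (v : Fin d → ℝ) :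
    ∑ j ∈ s, |v j| ≤ √(s.card) * l2norm v := by
  apply le_of_sq_le_sq _ (mul_nonneg (Real.sqrt_nonneg _) (l2norm_nonneg _))
  rw [mul_pow, Real.sq_sqrt (Nat.cast_nonneg _), l2norm_sq]
  refine sq_sum_le_card_mul_sum_sq.trans ?_
  simp only [sq_abs]
  gcongr
  exact Finset.subset_univ _

/-- A finite half-net of the unit ball, through which linear functionals are controlled. -/
lemma exists_finset_norming (d : ℕ) : ∃ N : Finset (Fin d → ℝ), N.card ≤ 5 ^ d ∧
    (∀ y ∈ N, l2norm y ≤ 1) ∧ ∀ (c : Fin d → ℝ) (ε : ℝ), (∀ y ∈ N, |c ⬝ᵥ y| ≤ ε) →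
      ∀ x, |c ⬝ᵥ x| ≤ 2 * ε * l2norm x := by
  classical
  let E := EuclideanSpace ℝ (Fin d)
  let good : Finset E → Prop := fun s =>
    (∀ y ∈ s, ‖y‖ ≤ 1) ∧ ∀ y ∈ s, ∀ z ∈ s, y ≠ z → 1 / 2 ≤ ‖y - z‖
  -- Doubling turns a `1/2`-separated subset of the unit ball into a `1`-separated subset of the
  -- ball of radius `2`, the setting of the Besicovitch packing bound.
  have hcard : ∀ s, good s → s.card ≤ 5 ^ d := by
    intro s hs
    have hinj : Function.Injective fun y : E => (2 : ℝ) • y := smul_right_injective E two_ne_zero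
    have h := Besicovitch.card_le_of_separated (s.image fun y : E => (2 : ℝ) • y) ?_ ?_
    · rwa [Finset.card_image_of_injective _ hinj, finrank_euclideanSpace_fin] at h
    · intro c hc
      obtain ⟨y, hy, rfl⟩ := Finset.mem_image.1 hc
      rw [norm_smul, Real.norm_ofNat]
      linarith [hs.1 y hy]
    · intro c hc e he hne
      obtain ⟨y, hy, rfl⟩ := Finset.mem_image.1 hc
      obtain ⟨z, hz, rfl⟩ := Finset.mem_image.1 he
      rw [← smul_sub, norm_smul, Real.norm_ofNat]
      linarith [hs.2 y hy z hz fun h => hne (by rw [h])]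
  -- A separated set of maximal cardinality is a net: a point far from all of it could be added.
  let K : Set ℕ := {k | ∃ s, good s ∧ s.card = k}
  have hKb : BddAbove K := ⟨5 ^ d, by rintro k ⟨s, hs, rfl⟩; exact hcard s hs⟩
  have hKn : K.Nonempty := ⟨0, ∅, by simp [good], by simp⟩
  obtain ⟨s, hs, hmax⟩ := Nat.sSup_mem hKn hKb
  have hnet : ∀ x : E, ‖x‖ ≤ 1 → ∃ y ∈ s, ‖x - y‖ ≤ 1 / 2 := by
    intro x hx
    by_contra! hcon
    have hxs : x ∉ s := fun h => by have := hcon x h; simp at this; linarith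
    have hgood : good (insert x s) := by
      refine ⟨fun y hy => ?_, fun y hy z hz hne => ?_⟩
      · rcases Finset.mem_insert.1 hy with rfl | hy
        · exact hx
        · exact hs.1 y hy
      · rcases Finset.mem_insert.1 hy with rfl | hy <;>
          rcases Finset.mem_insert.1 hz with rfl | hz
        · exact absurd rfl hne
        · exact (hcon z hz).le
        · rw [norm_sub_rev]; exact (hcon y (by assumption)).le
        · exact hs.2 y hy z hz hne
    have := le_csSup hKb ⟨insert x s, hgood, rfl⟩
    rw [← hmax, Finset.card_insert_of_notMem hxs] at this
    omega
  refine ⟨s.image fun y => y.ofLp, Finset.card_image_le.trans (hcard s hs), ?_, ?_⟩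
  · intro y hy
    obtain ⟨z, hz, rfl⟩ := Finset.mem_image.1 hy
    exact hs.1 z hz
  · intro c ε hc x
    have hc2 : l2norm c ≤ 2 * ε := by
      have hcpos := l2norm_nonneg c
      -- Testing `c` on its own direction and moving to a net point gives `‖c‖ ≤ ε + ‖c‖ / 2`. For
      -- `c = 0` the inverse is `0` and `x₀ = 0`.
      let x₀ : Fin d → ℝ := (l2norm c)⁻¹ • c
      have hx₀ : l2norm x₀ ≤ 1 := by
        rw [l2norm_smul, abs_inv, abs_of_nonneg hcpos]
        exact inv_mul_le_one
      obtain ⟨y, hy, hxy⟩ := hnet (WithLp.toLp 2 x₀) hx₀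
      have h1 := hc y.ofLp (Finset.mem_image_of_mem _ hy)
      have h2 := abs_dotProduct_le c (x₀ - y.ofLp)
      have h3 : l2norm (x₀ - y.ofLp) ≤ 1 / 2 := hxy
      have h4 : c ⬝ᵥ x₀ = l2norm c := by
        rw [dotProduct_smul, ← l2norm_sq_eq_dotProduct, smul_eq_mul, sq]
        by_cases h0 : l2norm c = 0
        · simp [h0]
        · field_simp
      rw [dotProduct_sub, h4] at h2
      have h5 := le_abs_self (c ⬝ᵥ y.ofLp)
      have h6 := le_abs_self (l2norm c - c ⬝ᵥ y.ofLp)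
      have h7 := mul_le_mul_of_nonneg_left h3 hcpos
      linarith
    exact (abs_dotProduct_le c x).trans (mul_le_mul_of_nonneg_right hc2 (l2norm_nonneg _))

end EuclideanNorm

/-! ### Uniform deviations of empirical bilinear forms. -/

section Bilinear

variable {𝒯 : Type*} [MeasurableSpace 𝒯] {ν : Measure 𝒯}

lemma SqExpBound.integrable_mul {l : ℝ} (hl : 0 < l) {A B b : 𝒯 → ℝ} (hA : SqExpBound l A ν)
    (hB : SqExpBound l B ν) (hb : Measurable b) (hb1 : ∀ t, |b t| ≤ 1) :
    Integrable (fun t => A t * B t * b t) ν :=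
  integrable_of_exp_abs hl ((hA.measurable.mul hB.measurable).mul hb)
    (hA.mul hl.le hB hb hb1).1

lemma dev_dotProduct_mul {Ω : Type*} {n : ℕ} {T : Fin n → Ω → 𝒯} {d d' : ℕ}
    {a : 𝒯 → Fin d → ℝ} {a' : 𝒯 → Fin d' → ℝ} {b : 𝒯 → ℝ}
    (hi : ∀ k j, Integrable (fun t => a t k * a' t j * b t) ν)
    (x : Fin d → ℝ) (y : Fin d' → ℝ) (ω : Ω) :
    dev T ν (fun t => (a t ⬝ᵥ x) * (a' t ⬝ᵥ y) * b t) ω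
      = ∑ k, ∑ j, x k * (y j * dev T ν (fun t => a t k * a' t j * b t) ω) := by
  have e : (fun t => (a t ⬝ᵥ x) * (a' t ⬝ᵥ y) * b t)
      = fun t => ∑ k, ∑ j, (x k * y j) * (a t k * a' t j * b t) := by
    funext t
    rw [dotProduct, dotProduct, Finset.sum_mul_sum, Finset.sum_mul]
    refine Finset.sum_congr rfl fun k _ => ?_
    rw [Finset.sum_mul]
    refine Finset.sum_congr rfl fun j _ => ?_
    ring
  rw [e, dev_sum _ _ fun k _ => integrable_finsetSum _ fun j _ => (hi k j).const_mul _]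
  refine Finset.sum_congr rfl fun k _ => ?_
  rw [dev_sum _ _ fun j _ => (hi k j).const_mul _]
  refine Finset.sum_congr rfl fun j _ => ?_
  rw [dev_const_mul]; ring

/-- Hölder's inequality between `ℓ¹` and `ℓ^∞`; useful because `ℓ¹` norms are small on the cone. -/
lemma abs_dev_dotProduct_mul_le {Ω : Type*} {n : ℕ} {T : Fin n → Ω → 𝒯} {d d' : ℕ}
    {a : 𝒯 → Fin d → ℝ} {a' : 𝒯 → Fin d' → ℝ} {b : 𝒯 → ℝ}
    (hi : ∀ k j, Integrable (fun t => a t k * a' t j * b t) ν) {ω : Ω} {x₀ : ℝ}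
    (h : ∀ k j, |dev T ν (fun t => a t k * a' t j * b t) ω| ≤ x₀)
    (x : Fin d → ℝ) (y : Fin d' → ℝ) :
    |dev T ν (fun t => (a t ⬝ᵥ x) * (a' t ⬝ᵥ y) * b t) ω|
      ≤ x₀ * ((∑ k, |x k|) * ∑ j, |y j|) := by
  rw [dev_dotProduct_mul hi, Finset.sum_mul_sum, Finset.mul_sum]
  refine (Finset.abs_sum_le_sum_abs _ _).trans (Finset.sum_le_sum fun k _ => ?_)
  rw [Finset.mul_sum]
  refine (Finset.abs_sum_le_sum_abs _ _).trans (Finset.sum_le_sum fun j _ => ?_)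
  rw [abs_mul, abs_mul, ← mul_assoc, mul_comm x₀]
  exact mul_le_mul_of_nonneg_left (h k j) (by positivity)

variable {Ω : Type*} [MeasurableSpace Ω] {P : Measure Ω} [IsProbabilityMeasure P]
  [IsProbabilityMeasure ν] {n : ℕ} {T : Fin n → Ω → 𝒯}

/-- Uniform control of the deviations of an empirical bilinear form over the unit ball. -/
lemma measure_not_bilinear_le (hn : 1 ≤ n) (hind : iIndepFun T P)
    (hid : ∀ i, IdentDistrib (T i) id P ν) {l : ℝ} (hl : 0 < l) {d : ℕ} {a : 𝒯 → Fin d → ℝ}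
    {b : 𝒯 → ℝ} (ha : ∀ x, l2norm x ≤ 1 → SqExpBound l (fun t => a t ⬝ᵥ x) ν)
    (hb : Measurable b) (hb1 : ∀ t, |b t| ≤ 1) {r : ℝ} (hr0 : 0 ≤ r) (hr : r ≤ l / 2) (ε : ℝ) :
    P.real {ω | ∀ x y, |dev T ν (fun t => (a t ⬝ᵥ x) * (a t ⬝ᵥ y) * b t) ω|
        ≤ 4 * ε * (l2norm x * l2norm y)}ᶜ
      ≤ 25 ^ d * (2 * Real.exp (n * (16 * r ^ 2 / l ^ 2 - r * ε))) := by
  classical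
  obtain ⟨N, hNc, hN1, hN⟩ := exists_finset_norming d
  have hcoord : ∀ k, SqExpBound l (fun t => a t k) ν := fun k => by
    simpa using ha (Pi.single k 1) (l2norm_single k).le
  have hi : ∀ k j, Integrable (fun t => a t k * a t j * b t) ν := fun k j =>
    (hcoord k).integrable_mul hl (hcoord j) hb hb1
  have hsub : {ω | ∀ x y, |dev T ν (fun t => (a t ⬝ᵥ x) * (a t ⬝ᵥ y) * b t) ω|
        ≤ 4 * ε * (l2norm x * l2norm y)}ᶜ
      ⊆ ⋃ z ∈ N ×ˢ N, {ω | ε ≤ |dev T ν (fun t => (a t ⬝ᵥ z.1) * (a t ⬝ᵥ z.2) * b t) ω|} := by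
    intro ω hω
    by_contra hcon
    apply hω
    simp only [Set.mem_iUnion, Set.mem_ofPred_eq, not_exists, not_le, Finset.mem_product,
      and_imp, Prod.forall] at hcon
    have hl1 : ∀ x y, dev T ν (fun t => (a t ⬝ᵥ x) * (a t ⬝ᵥ y) * b t) ω
        = (fun j => ∑ k, x k * dev T ν (fun t => a t k * a t j * b t) ω) ⬝ᵥ y := by
      intro x y
      rw [dev_dotProduct_mul hi, Finset.sum_comm, dotProduct]
      refine Finset.sum_congr rfl fun j _ => ?_
      rw [Finset.sum_mul]
      exact Finset.sum_congr rfl fun k _ => by ring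
    have hl2 : ∀ x y, dev T ν (fun t => (a t ⬝ᵥ x) * (a t ⬝ᵥ y) * b t) ω
        = (fun k => ∑ j, y j * dev T ν (fun t => a t k * a t j * b t) ω) ⬝ᵥ x := by
      intro x y
      rw [dev_dotProduct_mul hi, dotProduct]
      refine Finset.sum_congr rfl fun j _ => ?_
      rw [Finset.sum_mul]
      exact Finset.sum_congr rfl fun k _ => by ring
    -- The net extends the bound to all vectors in one argument and then in the other, each time at
    -- the price of a factor `2`.
    have h1 : ∀ x ∈ N, ∀ y, |dev T ν (fun t => (a t ⬝ᵥ x) * (a t ⬝ᵥ y) * b t) ω|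
        ≤ 2 * ε * l2norm y := by
      intro x hx y
      rw [hl1]
      refine hN _ ε (fun y' hy' => ?_) y
      rw [← hl1]
      exact (hcon x y' hx hy').le
    intro x y
    rw [hl2]
    have := hN (fun k => ∑ j, y j * dev T ν (fun t => a t k * a t j * b t) ω)
      (2 * ε * l2norm y) (fun x' hx' => by rw [← hl2]; exact h1 x' hx' y) x
    linarith
  have hmem : ∀ z ∈ N ×ˢ N,
      P.real {ω | ε ≤ |dev T ν (fun t => (a t ⬝ᵥ z.1) * (a t ⬝ᵥ z.2) * b t) ω|}
        ≤ 2 * Real.exp (n * (16 * r ^ 2 / l ^ 2 - r * ε)) := by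
    intro z hz
    have hz' := Finset.mem_product.1 hz
    have h1 := ha z.1 (hN1 _ hz'.1)
    have h2 := ha z.2 (hN1 _ hz'.2)
    obtain ⟨h3, h4⟩ := h1.mul hl.le h2 hb hb1
    exact measure_abs_dev_ge_le hn hind hid hl ((h1.measurable.mul h2.measurable).mul hb)
      h3 h4 hr0 hr ε
  calc _ ≤ P.real (⋃ z ∈ N ×ˢ N,
        {ω | ε ≤ |dev T ν (fun t => (a t ⬝ᵥ z.1) * (a t ⬝ᵥ z.2) * b t) ω|}) :=
        measureReal_mono hsub (measure_ne_top _ _)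
    _ ≤ _ := measureReal_biUnion_finset_le _ _
    _ ≤ _ := Finset.sum_le_card_nsmul _ _ _ hmem
    _ ≤ _ := by
      rw [nsmul_eq_mul]
      refine mul_le_mul_of_nonneg_right ?_ (by positivity)
      rw [Finset.card_product]
      have : N.card * N.card ≤ 25 ^ d := by
        calc N.card * N.card ≤ 5 ^ d * 5 ^ d := Nat.mul_le_mul hNc hNc
          _ = 25 ^ d := by rw [← mul_pow]; norm_num
      exact_mod_cast this

/-- Entrywise control of the deviations of an empirical cross-moment matrix. -/
lemma measure_not_entrywise_le (hn : 1 ≤ n) (hind : iIndepFun T P)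
    (hid : ∀ i, IdentDistrib (T i) id P ν) {l : ℝ} (hl : 0 < l) {d d' : ℕ}
    {a : 𝒯 → Fin d → ℝ} {a' : 𝒯 → Fin d' → ℝ} {b : 𝒯 → ℝ}
    (ha : ∀ k, SqExpBound l (fun t => a t k) ν) (ha' : ∀ j, SqExpBound l (fun t => a' t j) ν)
    (hb : Measurable b) (hb1 : ∀ t, |b t| ≤ 1) {r : ℝ} (hr0 : 0 ≤ r) (hr : r ≤ l / 2) (x : ℝ) :
    P.real {ω | ∀ k j, |dev T ν (fun t => a t k * a' t j * b t) ω| ≤ x}ᶜ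
      ≤ d * d' * (2 * Real.exp (n * (16 * r ^ 2 / l ^ 2 - r * x))) := by
  have hsub : {ω | ∀ k j, |dev T ν (fun t => a t k * a' t j * b t) ω| ≤ x}ᶜ
      ⊆ ⋃ z ∈ (Finset.univ : Finset (Fin d × Fin d')),
        {ω | x ≤ |dev T ν (fun t => a t z.1 * a' t z.2 * b t) ω|} := by
    intro ω hω
    by_contra hcon
    apply hω
    simp only [Set.mem_iUnion, Set.mem_ofPred_eq, not_exists, not_le, Finset.mem_univ,
      forall_const, Prod.forall] at hcon
    exact fun k j => (hcon k j).le
  calc _ ≤ _ := measureReal_mono hsub (measure_ne_top _ _)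
    _ ≤ _ := measureReal_biUnion_finset_le _ _
    _ ≤ _ := Finset.sum_le_card_nsmul _ _ _ fun z _ => by
      obtain ⟨h3, h4⟩ := (ha z.1).mul hl.le (ha' z.2) hb hb1
      exact measure_abs_dev_ge_le hn hind hid hl
        (((ha z.1).measurable.mul (ha' z.2).measurable).mul hb) h3 h4 hr0 hr x
    _ ≤ _ := by
      rw [nsmul_eq_mul]
      simp

end Bilinear
-- Population second moments under truncation.
lemma exists_eq_l2norm_smul {d : ℕ} (w : Fin d → ℝ) :
    ∃ w', l2norm w' ≤ 1 ∧ w = l2norm w • w' := by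
  by_cases h : l2norm w = 0
  · refine ⟨0, by simp [l2norm], ?_⟩
    have := norm_eq_zero.1 h
    rw [smul_zero]
    exact congrArg WithLp.ofLp this
  · refine ⟨(l2norm w)⁻¹ • w, ?_, by rw [smul_smul, mul_inv_cancel₀ h, one_smul]⟩
    rw [l2norm_smul, abs_inv, abs_of_nonneg (l2norm_nonneg _), inv_mul_cancel₀ h]

/-- The indicator of the event that the linear predictor is at most `τ` in absolute value. -/
noncomputable def bandIndicator {𝒯 : Type*} (η : 𝒯 → ℝ) (τ : ℝ) (t : 𝒯) : ℝ :=
  Set.indicator {t' | |η t'| ≤ τ} (fun _ => (1 : ℝ)) t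

lemma bandIndicator_mem_Icc {𝒯 : Type*} {η : 𝒯 → ℝ} (τ : ℝ) (t : 𝒯) :
    0 ≤ bandIndicator η τ t ∧ bandIndicator η τ t ≤ 1 := by
  unfold bandIndicator
  by_cases h : t ∈ {t' | |η t'| ≤ τ} <;> simp [h]

lemma abs_bandIndicator_le {𝒯 : Type*} {η : 𝒯 → ℝ} (τ : ℝ) (t : 𝒯) : |bandIndicator η τ t| ≤ 1 :=
  abs_le.2 ⟨by linarith [(bandIndicator_mem_Icc (η := η) τ t).1], (bandIndicator_mem_Icc τ t).2⟩

section Population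

variable {𝒯 : Type*} [MeasurableSpace 𝒯] {ν : Measure 𝒯}

lemma measurable_bandIndicator {η : 𝒯 → ℝ} (hη : Measurable η) (τ : ℝ) :
    Measurable (bandIndicator η τ) := by
  refine measurable_const.indicator ?_
  have h : Measurable fun t => |η t| := by simpa [Real.norm_eq_abs] using hη.norm
  exact measurableSet_le h measurable_const

lemma SqExpBound.integrable_sq_mul {l : ℝ} (hl : 0 < l) {A b : 𝒯 → ℝ} (hA : SqExpBound l A ν)
    (hb : Measurable b) (hb1 : ∀ t, |b t| ≤ 1) : Integrable (fun t => A t ^ 2 * b t) ν := by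
  simpa only [sq] using hA.integrable_mul hl hA hb hb1

lemma SqExpBound.integral_sq_le {l : ℝ} (hl : 0 < l) {A : 𝒯 → ℝ} (hA : SqExpBound l A ν) :
    Integrable (fun t => A t ^ 2) ν ∧ ∫ t, A t ^ 2 ∂ν ≤ 2 / l := by
  have hi : Integrable (fun t => A t ^ 2) ν := by
    simpa using hA.integrable_sq_mul hl (b := fun _ => 1) measurable_const (by simp)
  refine ⟨hi, ?_⟩
  have h : ∫ t, A t ^ 2 ∂ν ≤ ∫ t, l⁻¹ * Real.exp (l * A t ^ 2) ∂ν := by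
    refine integral_mono hi (hA.integrable.const_mul _) fun t => ?_
    simp only
    rw [← div_eq_inv_mul, le_div_iff₀ hl]
    linarith [Real.add_one_le_exp (l * A t ^ 2)]
  rw [integral_const_mul] at h
  calc _ ≤ _ := h
    _ ≤ l⁻¹ * 2 := mul_le_mul_of_nonneg_left hA.integral_le (by positivity)
    _ = 2 / l := by ring

/-- Off the band `η² ≥ τ²`, so `exp (l η²) ≥ l τ²` is large. Hence `A²` is there at most `ε / 4`
times the sum of the two exponentials, each of which has integral at most `2`. -/
lemma SqExpBound.integral_sq_mul_one_sub_bandIndicator_le {l : ℝ} (hl : 0 < l) {A η : 𝒯 → ℝ}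
    (hA : SqExpBound l A ν) (hη : SqExpBound l η ν) {ε τ : ℝ} (hε : 0 < ε) (hτ : 0 < τ)
    (h8 : 8 ≤ ε ^ 2 * l ^ 3 * τ ^ 2) :
    ∫ t, A t ^ 2 * (1 - bandIndicator η τ t) ∂ν ≤ ε := by
  have hτm := measurable_bandIndicator hη.measurable τ
  have hi : Integrable (fun t => A t ^ 2 * (1 - bandIndicator η τ t)) ν := by
    refine hA.integrable_sq_mul hl (by fun_prop) fun t => ?_
    have := bandIndicator_mem_Icc (η := η) τ t
    rw [abs_le]; constructor <;> linarith
  have hle : ∀ t, A t ^ 2 * (1 - bandIndicator η τ t)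
      ≤ ε / 4 * Real.exp (l * A t ^ 2) + ε / 4 * Real.exp (l * η t ^ 2) := by
    intro t
    by_cases h : t ∈ {t' | |η t'| ≤ τ}
    · have : bandIndicator η τ t = 1 := by simp [bandIndicator, Set.indicator_of_mem h]
      rw [this]; simp only [sub_self, mul_zero]; positivity
    · have h0 : bandIndicator η τ t = 0 := by simp [bandIndicator, Set.indicator_of_notMem h]
      rw [h0, sub_zero, mul_one]
      have h1 : τ ^ 2 ≤ η t ^ 2 := by
        rw [← sq_abs (η t)]
        exact pow_le_pow_left₀ hτ.le (not_le.1 h).le 2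
      have h2 := sq_le_two_mul_exp (y := l * A t ^ 2) (by positivity)
      have h3 := Real.add_one_le_exp (l * η t ^ 2)
      set a := A t ^ 2
      have ha : 0 ≤ a := sq_nonneg _
      set E := Real.exp (l * a)
      set F := Real.exp (l * η t ^ 2)
      have h4 : l * τ ^ 2 ≤ F := by nlinarith
      have h5 : l ^ 2 * a ^ 2 ≤ 2 * E := by rw [← mul_pow]; exact h2
      have h6 : 8 ≤ ε ^ 2 * l ^ 2 * F := by
        calc (8 : ℝ) ≤ ε ^ 2 * l ^ 2 * (l * τ ^ 2) := by linarith
          _ ≤ _ := mul_le_mul_of_nonneg_left h4 (by positivity)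
      -- A completed square whose weight makes the two terms at most `2 ε E` and `2 ε F`.
      have h7 : 8 * a ≤ ε * (l ^ 2 * a ^ 2) + 16 / (ε * l ^ 2) := by
        have : 0 ≤ (ε * l ^ 2 * a - 4) ^ 2 / (ε * l ^ 2) := by positivity
        have e : (ε * l ^ 2 * a - 4) ^ 2 / (ε * l ^ 2)
            = ε * (l ^ 2 * a ^ 2) - 8 * a + 16 / (ε * l ^ 2) := by
          field_simp; ring
        linarith
      have h8 : 16 / (ε * l ^ 2) ≤ 2 * ε * F := by
        rw [div_le_iff₀ (by positivity)]; nlinarith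
      nlinarith
  have hs := (hA.integrable.const_mul (ε / 4)).add (hη.integrable.const_mul (ε / 4))
  refine (integral_mono hi hs hle).trans ?_
  rw [integral_add' (hA.integrable.const_mul _) (hη.integrable.const_mul _),
    integral_const_mul, integral_const_mul]
  nlinarith [hA.integral_le, hη.integral_le]

variable {d : ℕ} {a : 𝒯 → Fin d → ℝ} {l : ℝ}

lemma integral_dotProduct_sq_le (hl : 0 < l)
    (ha : ∀ x, l2norm x ≤ 1 → SqExpBound l (fun t => a t ⬝ᵥ x) ν) (x : Fin d → ℝ) :
    ∫ t, (a t ⬝ᵥ x) ^ 2 ∂ν ≤ 2 / l * l2norm x ^ 2 := by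
  obtain ⟨x', hx', e⟩ := exists_eq_l2norm_smul x
  have h := ((ha x' hx').integral_sq_le hl).2
  have e' : ∀ t, (a t ⬝ᵥ x) ^ 2 = l2norm x ^ 2 * (a t ⬝ᵥ x') ^ 2 := by
    intro t
    conv_lhs => rw [e]
    rw [dotProduct_smul, smul_eq_mul, mul_pow]
  simp_rw [e', integral_const_mul]
  nlinarith [mul_le_mul_of_nonneg_left h (sq_nonneg (l2norm x))]

lemma integral_dotProduct_sq_mul_one_sub_bandIndicator_le (hl : 0 < l)
    (ha : ∀ x, l2norm x ≤ 1 → SqExpBound l (fun t => a t ⬝ᵥ x) ν) {η : 𝒯 → ℝ}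
    (hη : SqExpBound l η ν) {ε τ : ℝ} (hε : 0 < ε) (hτ : 0 < τ)
    (h8 : 8 ≤ ε ^ 2 * l ^ 3 * τ ^ 2) (x : Fin d → ℝ) :
    ∫ t, (a t ⬝ᵥ x) ^ 2 * (1 - bandIndicator η τ t) ∂ν ≤ ε * l2norm x ^ 2 := by
  obtain ⟨x', hx', e⟩ := exists_eq_l2norm_smul x
  have h := (ha x' hx').integral_sq_mul_one_sub_bandIndicator_le hl hη hε hτ h8
  have e' : ∀ t, (a t ⬝ᵥ x) ^ 2 * (1 - bandIndicator η τ t)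
      = l2norm x ^ 2 * ((a t ⬝ᵥ x') ^ 2 * (1 - bandIndicator η τ t)) := by
    intro t
    conv_lhs => rw [e]
    rw [dotProduct_smul, smul_eq_mul, mul_pow]; ring
  simp_rw [e', integral_const_mul]
  nlinarith [mul_le_mul_of_nonneg_left h (sq_nonneg (l2norm x))]

lemma integrable_dotProduct_mul {d' : ℕ} {a' : 𝒯 → Fin d' → ℝ} {b : 𝒯 → ℝ} (hl : 0 < l)
    (ha : ∀ x, l2norm x ≤ 1 → SqExpBound l (fun t => a t ⬝ᵥ x) ν)
    (ha' : ∀ x, l2norm x ≤ 1 → SqExpBound l (fun t => a' t ⬝ᵥ x) ν)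
    (hb : Measurable b) (hb1 : ∀ t, |b t| ≤ 1) (x : Fin d → ℝ) (y : Fin d' → ℝ) :
    Integrable (fun t => (a t ⬝ᵥ x) * (a' t ⬝ᵥ y) * b t) ν := by
  obtain ⟨x', hx', ex⟩ := exists_eq_l2norm_smul x
  obtain ⟨y', hy', ey⟩ := exists_eq_l2norm_smul y
  have h := ((ha x' hx').integrable_mul hl (ha' y' hy') hb hb1).const_mul (l2norm x * l2norm y)
  refine h.congr (Eventually.of_forall fun t => ?_)
  simp only
  conv_rhs => rw [ex, ey]
  rw [dotProduct_smul, dotProduct_smul, smul_eq_mul, smul_eq_mul]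
  ring

variable {d' : ℕ} {a' : 𝒯 → Fin d' → ℝ}

/-- Truncation at a large level preserves a lower bound on the second moments. -/
lemma le_integral_sq_mul_bandIndicator (hl : 0 < l)
    (ha : ∀ x, l2norm x ≤ 1 → SqExpBound l (fun t => a t ⬝ᵥ x) ν)
    (ha' : ∀ x, l2norm x ≤ 1 → SqExpBound l (fun t => a' t ⬝ᵥ x) ν) {η : 𝒯 → ℝ}
    (hη : SqExpBound l η ν) {κ τ : ℝ} (hκ : 0 < κ) (hτ : 0 < τ)
    (h8 : 128 ≤ κ ^ 2 * l ^ 3 * τ ^ 2)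
    (x : Fin d → ℝ) (y : Fin d' → ℝ)
    (hlow : κ * (l2norm x ^ 2 + l2norm y ^ 2) ≤ ∫ t, (a t ⬝ᵥ x + a' t ⬝ᵥ y) ^ 2 ∂ν) :
    κ / 2 * (l2norm x ^ 2 + l2norm y ^ 2)
      ≤ ∫ t, (a t ⬝ᵥ x + a' t ⬝ᵥ y) ^ 2 * bandIndicator η τ t ∂ν := by
  have hm := measurable_bandIndicator hη.measurable τ
  have hm1 : Measurable fun t => 1 - bandIndicator η τ t := by fun_prop
  have hb1 : ∀ t, |1 - bandIndicator η τ t| ≤ 1 := fun t => by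
    have := bandIndicator_mem_Icc (η := η) τ t
    rw [abs_le]; constructor <;> linarith
  -- Tolerance `κ / 4` for each of the two parts, doubled by `(A + B)² ≤ 2 A² + 2 B²`, loses `κ /
  -- 2`; this explains `128 = 8 · 4²`.
  have h1 := integral_dotProduct_sq_mul_one_sub_bandIndicator_le hl ha hη
    (show 0 < κ / 4 by linarith) hτ (by linarith) x
  have h2 := integral_dotProduct_sq_mul_one_sub_bandIndicator_le hl ha' hη
    (show 0 < κ / 4 by linarith) hτ (by linarith) y
  have hint : ∀ b : 𝒯 → ℝ, Measurable b → (∀ t, |b t| ≤ 1) →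
      Integrable (fun t => (a t ⬝ᵥ x + a' t ⬝ᵥ y) ^ 2 * b t) ν := by
    intro b hb hb1
    have := ((integrable_dotProduct_mul hl ha ha hb hb1 x x).add
      ((integrable_dotProduct_mul hl ha ha' hb hb1 x y).const_mul 2)).add
      (integrable_dotProduct_mul hl ha' ha' hb hb1 y y)
    refine this.congr (Eventually.of_forall fun t => ?_)
    simp only [Pi.add_apply]; ring
  have hi1 : Integrable (fun t => (a t ⬝ᵥ x) ^ 2 * (1 - bandIndicator η τ t)) ν := by
    simpa only [sq] using integrable_dotProduct_mul hl ha ha hm1 hb1 x x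
  have hi2 : Integrable (fun t => (a' t ⬝ᵥ y) ^ 2 * (1 - bandIndicator η τ t)) ν := by
    simpa only [sq] using integrable_dotProduct_mul hl ha' ha' hm1 hb1 y y
  have h3 : ∫ t, (a t ⬝ᵥ x + a' t ⬝ᵥ y) ^ 2 * (1 - bandIndicator η τ t) ∂ν
      ≤ ∫ t, (2 * ((a t ⬝ᵥ x) ^ 2 * (1 - bandIndicator η τ t))
        + 2 * ((a' t ⬝ᵥ y) ^ 2 * (1 - bandIndicator η τ t))) ∂ν := by
    refine integral_mono (hint _ hm1 hb1) ((hi1.const_mul 2).add (hi2.const_mul 2)) fun t => ?_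
    simp only
    have := bandIndicator_mem_Icc (η := η) τ t
    nlinarith [mul_nonneg (sq_nonneg (a t ⬝ᵥ x - a' t ⬝ᵥ y)) (sub_nonneg.2 this.2)]
  rw [integral_add (hi1.const_mul 2) (hi2.const_mul 2), integral_const_mul,
    integral_const_mul] at h3
  have h4 : ∫ t, (a t ⬝ᵥ x + a' t ⬝ᵥ y) ^ 2 ∂ν
      = ∫ t, (a t ⬝ᵥ x + a' t ⬝ᵥ y) ^ 2 * bandIndicator η τ t ∂ν
        + ∫ t, (a t ⬝ᵥ x + a' t ⬝ᵥ y) ^ 2 * (1 - bandIndicator η τ t) ∂ν := by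
    rw [← integral_add (hint _ hm (abs_bandIndicator_le τ)) (hint _ hm1 hb1)]
    refine integral_congr_ae (Eventually.of_forall fun t => ?_)
    simp only; ring
  linarith

end Population

/-! ### Lower bound for the empirical form on the cone. -/

lemma sum_abs_le_of_mem_cone {p : ℕ} {S : Finset (Fin p)} {Δ : Fin p → ℝ} (h : Δ ∈ cone S) :
    ∑ j, |Δ j| ≤ 4 * (√S.card * l2norm Δ) := by
  have h' : ∑ j ∈ Sᶜ, |Δ j| ≤ 3 * ∑ j ∈ S, |Δ j| := h
  rw [← Finset.sum_add_sum_compl S]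
  linarith [sum_abs_le_sqrt_card_mul_l2norm S Δ]

section Empirical

variable {Ω 𝒯 : Type*} [MeasurableSpace 𝒯] {ν : Measure 𝒯} {n : ℕ} {T : Fin n → Ω → 𝒯}
  {p q : ℕ} {u : 𝒯 → Fin q → ℝ} {z : 𝒯 → Fin p → ℝ} {l : ℝ}

/-- The truncated empirical quadratic form is bounded below on `ℝ^q × C(S)` when the
empirical second moments are close to their expectations. -/
lemma le_empirical_sq_mul_bandIndicator (hl : 0 < l)
    (hu : ∀ x, l2norm x ≤ 1 → SqExpBound l (fun t => u t ⬝ᵥ x) ν)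
    (hz : ∀ x, l2norm x ≤ 1 → SqExpBound l (fun t => z t ⬝ᵥ x) ν) {η : 𝒯 → ℝ}
    (hη : SqExpBound l η ν) {κ τ : ℝ} (hκ : 0 < κ) (hτ : 0 < τ)
    (h8 : 128 ≤ κ ^ 2 * l ^ 3 * τ ^ 2)
    (hlow : ∀ x y, κ * (l2norm x ^ 2 + l2norm y ^ 2) ≤ ∫ t, (u t ⬝ᵥ x + z t ⬝ᵥ y) ^ 2 ∂ν)
    {ω : Ω} {ε x₀ : ℝ} (hε : ε ≤ κ / 64) {S : Finset (Fin p)} (hx₀ : 0 ≤ x₀)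
    (hS : S.card * x₀ ≤ κ / 256) (hqS : √q * √S.card * x₀ ≤ κ / 64)
    (huu : ∀ x y, |dev T ν (fun t => (u t ⬝ᵥ x) * (u t ⬝ᵥ y) * bandIndicator η τ t) ω|
      ≤ 4 * ε * (l2norm x * l2norm y))
    (huz : ∀ k j, |dev T ν (fun t => u t k * z t j * bandIndicator η τ t) ω| ≤ x₀)
    (hzz : ∀ k j, |dev T ν (fun t => z t k * z t j * bandIndicator η τ t) ω| ≤ x₀)
    (w : Fin q → ℝ) {Δ : Fin p → ℝ} (hΔ : Δ ∈ cone S) :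
    κ / 4 * l2norm Δ ^ 2
      ≤ (1 / (n : ℝ)) * ∑ i, (u (T i ω) ⬝ᵥ w + z (T i ω) ⬝ᵥ Δ) ^ 2
        * bandIndicator η τ (T i ω) := by
  have hm := measurable_bandIndicator hη.measurable τ
  have hb1 := abs_bandIndicator_le (η := η) τ
  have hpop := le_integral_sq_mul_bandIndicator hl hu hz hη hκ hτ h8 w Δ (hlow w Δ)
  have iuu := integrable_dotProduct_mul hl hu hu hm hb1
  have iuz := integrable_dotProduct_mul hl hu hz hm hb1
  have izz := integrable_dotProduct_mul hl hz hz hm hb1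
  have hdev : dev T ν (fun t => (u t ⬝ᵥ w + z t ⬝ᵥ Δ) ^ 2 * bandIndicator η τ t) ω
      = dev T ν (fun t => (u t ⬝ᵥ w) * (u t ⬝ᵥ w) * bandIndicator η τ t) ω
        + (2 * dev T ν (fun t => (u t ⬝ᵥ w) * (z t ⬝ᵥ Δ) * bandIndicator η τ t) ω
        + dev T ν (fun t => (z t ⬝ᵥ Δ) * (z t ⬝ᵥ Δ) * bandIndicator η τ t) ω) := by
    have e : (fun t => (u t ⬝ᵥ w + z t ⬝ᵥ Δ) ^ 2 * bandIndicator η τ t)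
        = fun t => ∑ i : Fin 3, ![fun t => (u t ⬝ᵥ w) * (u t ⬝ᵥ w) * bandIndicator η τ t,
          fun t => 2 * ((u t ⬝ᵥ w) * (z t ⬝ᵥ Δ) * bandIndicator η τ t),
          fun t => (z t ⬝ᵥ Δ) * (z t ⬝ᵥ Δ) * bandIndicator η τ t] i t := by
      funext t
      simp only [Fin.sum_univ_three, Matrix.cons_val]
      ring
    rw [e, dev_sum]
    · simp only [Fin.sum_univ_three, Matrix.cons_val, dev_const_mul]
      ring
    · intro i _
      fin_cases i
      · exact iuu w w
      · exact (iuz w Δ).const_mul 2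
      · exact izz Δ Δ
  have hcoord : ∀ {d d' : ℕ} {a : 𝒯 → Fin d → ℝ} {a' : 𝒯 → Fin d' → ℝ},
      (∀ x y, Integrable (fun t => (a t ⬝ᵥ x) * (a' t ⬝ᵥ y) * bandIndicator η τ t) ν) →
      ∀ k j, Integrable (fun t => a t k * a' t j * bandIndicator η τ t) ν := by
    intro d d' a a' h k j
    simpa using h (Pi.single k 1) (Pi.single j 1)
  have h1 := (abs_le.1 (huu w w)).1
  have h2 := (abs_le.1 (abs_dev_dotProduct_mul_le (hcoord iuz) huz w Δ)).1
  have h3 := (abs_le.1 (abs_dev_dotProduct_mul_le (hcoord izz) hzz Δ Δ)).1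
  have hcone := sum_abs_le_of_mem_cone hΔ
  have hw : ∑ k, |w k| ≤ √q * l2norm w := by
    simpa using sum_abs_le_sqrt_card_mul_l2norm Finset.univ w
  have hwn := l2norm_nonneg w
  have hΔn := l2norm_nonneg Δ
  have hsn := Real.sqrt_nonneg (S.card : ℝ)
  have hqn := Real.sqrt_nonneg (q : ℝ)
  -- Error budget: `b1`, twice `b2` and `b3` together cost `κ / 8` on each of `‖w‖²` and `‖Δ‖²`,
  -- well within the population bound `κ / 2`.
  have b1 : 4 * ε * (l2norm w * l2norm w) ≤ κ / 16 * l2norm w ^ 2 := by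
    nlinarith [mul_le_mul_of_nonneg_right hε (mul_nonneg hwn hwn)]
  have b2 : x₀ * ((∑ k, |w k|) * ∑ j, |Δ j|) ≤ κ / 32 * (l2norm w ^ 2 + l2norm Δ ^ 2) := by
    calc x₀ * ((∑ k, |w k|) * ∑ j, |Δ j|)
        ≤ x₀ * ((√q * l2norm w) * (4 * (√S.card * l2norm Δ))) := by gcongr
      _ = 4 * (√q * √S.card * x₀) * (l2norm w * l2norm Δ) := by ring
      _ ≤ 4 * (κ / 64) * (l2norm w * l2norm Δ) := by gcongr
      _ ≤ _ := by nlinarith [mul_nonneg hκ.le (sq_nonneg (l2norm w - l2norm Δ))]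
  have b3 : x₀ * ((∑ k, |Δ k|) * ∑ j, |Δ j|) ≤ κ / 16 * l2norm Δ ^ 2 := by
    calc x₀ * ((∑ k, |Δ k|) * ∑ j, |Δ j|)
        ≤ x₀ * ((4 * (√S.card * l2norm Δ)) * (4 * (√S.card * l2norm Δ))) := by gcongr
      _ = 16 * ((√S.card) ^ 2 * x₀) * l2norm Δ ^ 2 := by ring
      _ = 16 * (S.card * x₀) * l2norm Δ ^ 2 := by rw [Real.sq_sqrt (Nat.cast_nonneg _)]
      _ ≤ 16 * (κ / 256) * l2norm Δ ^ 2 := by gcongr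
      _ = _ := by ring
  have hemp : (1 / (n : ℝ)) * ∑ i, (u (T i ω) ⬝ᵥ w + z (T i ω) ⬝ᵥ Δ) ^ 2
        * bandIndicator η τ (T i ω)
      = dev T ν (fun t => (u t ⬝ᵥ w + z t ⬝ᵥ Δ) ^ 2 * bandIndicator η τ t) ω
        + ∫ t, (u t ⬝ᵥ w + z t ⬝ᵥ Δ) ^ 2 * bandIndicator η τ t ∂ν := by
    simp only [dev]; ring
  rw [hemp, hdev]
  nlinarith [mul_nonneg hκ.le (sq_nonneg (l2norm w)), mul_nonneg hκ.le (sq_nonneg (l2norm Δ))]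

lemma empirical_sq_le (hl : 0 < l)
    (hz : ∀ x, l2norm x ≤ 1 → SqExpBound l (fun t => z t ⬝ᵥ x) ν) {ω : Ω} {ε : ℝ}
    (hop : ∀ x y, |dev T ν (fun t => (z t ⬝ᵥ x) * (z t ⬝ᵥ y) * 1) ω|
      ≤ 4 * ε * (l2norm x * l2norm y)) (Δ : Fin p → ℝ) :
    (1 / (n : ℝ)) * ∑ i, (z (T i ω) ⬝ᵥ Δ) ^ 2 ≤ (2 / l + 4 * ε) * l2norm Δ ^ 2 := by
  have h1 := (abs_le.1 (hop Δ Δ)).2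
  have h2 := integral_dotProduct_sq_le hl hz Δ
  simp only [dev, mul_one, ← sq] at h1
  linarith

/-- The lower bound on the quadratic form, after removal of an arbitrary perturbation. -/
lemma le_empirical_sq_add_mul_bandIndicator (hl : 0 < l)
    (hu : ∀ x, l2norm x ≤ 1 → SqExpBound l (fun t => u t ⬝ᵥ x) ν)
    (hz : ∀ x, l2norm x ≤ 1 → SqExpBound l (fun t => z t ⬝ᵥ x) ν) {η : 𝒯 → ℝ}
    (hη : SqExpBound l η ν) {κ τ : ℝ} (hκ : 0 < κ) (hτ : 0 < τ)
    (h8 : 128 ≤ κ ^ 2 * l ^ 3 * τ ^ 2)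
    (hlow : ∀ x y, κ * (l2norm x ^ 2 + l2norm y ^ 2) ≤ ∫ t, (u t ⬝ᵥ x + z t ⬝ᵥ y) ^ 2 ∂ν)
    {ω : Ω} {ε x₀ ε' : ℝ} (hε : ε ≤ κ / 64) {S : Finset (Fin p)} (hx₀ : 0 ≤ x₀)
    (hS : S.card * x₀ ≤ κ / 256) (hqS : √q * √S.card * x₀ ≤ κ / 64)
    (huu : ∀ x y, |dev T ν (fun t => (u t ⬝ᵥ x) * (u t ⬝ᵥ y) * bandIndicator η τ t) ω|
      ≤ 4 * ε * (l2norm x * l2norm y))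
    (huz : ∀ k j, |dev T ν (fun t => u t k * z t j * bandIndicator η τ t) ω| ≤ x₀)
    (hzz : ∀ k j, |dev T ν (fun t => z t k * z t j * bandIndicator η τ t) ω| ≤ x₀)
    (hop : ∀ x y, |dev T ν (fun t => (z t ⬝ᵥ x) * (z t ⬝ᵥ y) * 1) ω|
      ≤ 4 * ε' * (l2norm x * l2norm y))
    (w : Fin q → ℝ) {Δ₁ : Fin p → ℝ} (hΔ : Δ₁ ∈ cone S) (Δ₂ : Fin p → ℝ) :
    κ / 8 * l2norm Δ₁ ^ 2 - (2 / l + 4 * ε') * l2norm Δ₂ ^ 2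
      ≤ (1 / (n : ℝ)) * ∑ i, (u (T i ω) ⬝ᵥ w + z (T i ω) ⬝ᵥ (Δ₁ + Δ₂)) ^ 2
        * bandIndicator η τ (T i ω) := by
  have h1 := le_empirical_sq_mul_bandIndicator hl hu hz hη hκ hτ h8 hlow hε hx₀ hS hqS huu huz hzz
    w hΔ
  have h2 := empirical_sq_le hl hz hop Δ₂
  have h3 : ∑ i, ((1 / 2) * ((u (T i ω) ⬝ᵥ w + z (T i ω) ⬝ᵥ Δ₁) ^ 2 * bandIndicator η τ (T i ω))
        - (z (T i ω) ⬝ᵥ Δ₂) ^ 2)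
      ≤ ∑ i, (u (T i ω) ⬝ᵥ w + z (T i ω) ⬝ᵥ (Δ₁ + Δ₂)) ^ 2 * bandIndicator η τ (T i ω) := by
    refine Finset.sum_le_sum fun i _ => ?_
    obtain ⟨hb0, hb1⟩ := bandIndicator_mem_Icc (η := η) τ (T i ω)
    rw [dotProduct_add]
    set A := u (T i ω) ⬝ᵥ w + z (T i ω) ⬝ᵥ Δ₁ with hA
    set B := z (T i ω) ⬝ᵥ Δ₂
    rw [← add_assoc, ← hA]
    -- The identity `(A + B)² - A² / 2 + B² = (A + 2 B)² / 2`, weighted by an indicator in `[0, 1]`.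
    nlinarith [mul_nonneg (sq_nonneg (A + 2 * B)) hb0,
      mul_nonneg (sq_nonneg B) (sub_nonneg.2 hb1)]
  rw [Finset.sum_sub_distrib, ← Finset.mul_sum] at h3
  have h4 := mul_le_mul_of_nonneg_left h3 (show 0 ≤ 1 / (n : ℝ) by positivity)
  linarith

end Empirical
-- Probability of the lower bound.
lemma twentyFive_le_exp_four : (25 : ℝ) ≤ Real.exp 4 := by
  have h := Real.quadratic_le_exp_of_nonneg (show (0 : ℝ) ≤ 2 by norm_num)
  have e : Real.exp 4 = Real.exp 2 * Real.exp 2 := by rw [← Real.exp_add]; norm_num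
  rw [e]; nlinarith

section Probability

variable {Ω 𝒯 : Type*} [MeasurableSpace Ω] [MeasurableSpace 𝒯] {P : Measure Ω}
  [IsProbabilityMeasure P] {ν : Measure 𝒯} [IsProbabilityMeasure ν] {n : ℕ} {T : Fin n → Ω → 𝒯}
  {p q : ℕ} {u : 𝒯 → Fin q → ℝ} {z : 𝒯 → Fin p → ℝ} {l : ℝ}

/-- With high probability, the truncated empirical quadratic form is bounded below on the cone,
up to arbitrary perturbations. -/
lemma measure_compl_empirical_lower_bound_le (hn : 1 ≤ n) (hind : iIndepFun T P)
    (hid : ∀ i, IdentDistrib (T i) id P ν) (hl : 0 < l)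
    (hu : ∀ x, l2norm x ≤ 1 → SqExpBound l (fun t => u t ⬝ᵥ x) ν)
    (hz : ∀ x, l2norm x ≤ 1 → SqExpBound l (fun t => z t ⬝ᵥ x) ν) {η : 𝒯 → ℝ}
    (hη : SqExpBound l η ν) {κ τ : ℝ} (hκ : 0 < κ) (hτ : 0 < τ)
    (h8 : 128 ≤ κ ^ 2 * l ^ 3 * τ ^ 2)
    (hlow : ∀ x y, κ * (l2norm x ^ 2 + l2norm y ^ 2) ≤ ∫ t, (u t ⬝ᵥ x + z t ⬝ᵥ y) ^ 2 ∂ν)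
    {S : Finset (Fin p)} {x₀ ε : ℝ} (hx₀ : 0 ≤ x₀) (hx₀l : x₀ * l ≤ 16)
    (hε0 : 0 ≤ ε) (hε : ε ≤ κ / 64) (hεl : ε * l ≤ 16)
    (hS : S.card * x₀ ≤ κ / 256) (hqS : √q * √S.card * x₀ ≤ κ / 64) :
    P.real {ω | ∀ w : Fin q → ℝ, ∀ Δ₁ ∈ cone S, ∀ Δ₂ : Fin p → ℝ,
      κ / 8 * l2norm Δ₁ ^ 2 - (34 / l + 40 / l * (p / n)) * l2norm Δ₂ ^ 2
        ≤ (1 / (n : ℝ)) * ∑ i, (u (T i ω) ⬝ᵥ w + z (T i ω) ⬝ᵥ (Δ₁ + Δ₂)) ^ 2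
          * bandIndicator η τ (T i ω)}ᶜ
      ≤ 25 ^ q * (2 * Real.exp (-(n * (ε ^ 2 * l ^ 2 / 64))))
        + (q * p + p * p) * (2 * Real.exp (-(n * (x₀ ^ 2 * l ^ 2 / 64))))
        + 2 * Real.exp (-p) := by
  have hn' : (0 : ℝ) < n := by exact_mod_cast hn
  have hm := measurable_bandIndicator hη.measurable τ
  have hb1 := abs_bandIndicator_le (η := η) τ
  -- The choice `r = y l² / 32` minimises `16 r² / l² - r y`; the constraint `r ≤ l / 2` then reads
  -- `y l ≤ 16`.
  have hexp : ∀ y : ℝ, (n : ℝ) * (16 * (y * l ^ 2 / 32) ^ 2 / l ^ 2 - y * l ^ 2 / 32 * y)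
      = -(n * (y ^ 2 * l ^ 2 / 64)) := by
    intro y; field_simp; ring
  have hr : ∀ y : ℝ, y * l ≤ 16 → y * l ^ 2 / 32 ≤ l / 2 := by
    intro y hy; nlinarith
  have huc : ∀ k, SqExpBound l (fun t => u t k) ν := fun k => by
    simpa using hu (Pi.single k 1) (l2norm_single k).le
  have hzc : ∀ k, SqExpBound l (fun t => z t k) ν := fun k => by
    simpa using hz (Pi.single k 1) (l2norm_single k).le
  have e1 := measure_not_bilinear_le hn hind hid hl hu hm hb1
    (show 0 ≤ ε * l ^ 2 / 32 by positivity) (hr ε hεl) ε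
  have e2 := measure_not_entrywise_le hn hind hid hl huc hzc hm hb1
    (show 0 ≤ x₀ * l ^ 2 / 32 by positivity) (hr x₀ hx₀l) x₀
  have e3 := measure_not_entrywise_le hn hind hid hl hzc hzc hm hb1
    (show 0 ≤ x₀ * l ^ 2 / 32 by positivity) (hr x₀ hx₀l) x₀
  -- At `r = l / 2` this level makes the exponent exactly `-5 p`: `4 p` pays for the net of size `25
  -- ^ p ≤ exp (4 p)` and `exp (-p)` remains.
  have e4 := measure_not_bilinear_le hn hind hid hl hz (b := fun _ => 1) measurable_const
    (by simp) (show 0 ≤ l / 2 by positivity) le_rfl (2 / l * (4 + 5 * (p / n)))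
  rw [hexp] at e1 e2 e3
  have e4' : (25 : ℝ) ^ p * (2 * Real.exp (n * (16 * (l / 2) ^ 2 / l ^ 2
      - l / 2 * (2 / l * (4 + 5 * (p / n)))))) ≤ 2 * Real.exp (-p) := by
    have h1 : (n : ℝ) * (16 * (l / 2) ^ 2 / l ^ 2 - l / 2 * (2 / l * (4 + 5 * (p / n))))
        = -(p : ℝ) + p * (-4) := by
      field_simp; ring
    have h3 : (25 : ℝ) ^ p * Real.exp (p * (-4)) ≤ 1 := by
      rw [Real.exp_nat_mul, ← mul_pow]
      refine pow_le_one₀ (by positivity) ?_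
      rw [Real.exp_neg, ← div_eq_mul_inv, div_le_one (Real.exp_pos _)]
      exact twentyFive_le_exp_four
    rw [h1, Real.exp_add]
    nlinarith [mul_le_mul_of_nonneg_left h3 (Real.exp_pos (-(p : ℝ))).le]
  have hsub : {ω | ∀ w : Fin q → ℝ, ∀ Δ₁ ∈ cone S, ∀ Δ₂ : Fin p → ℝ,
      κ / 8 * l2norm Δ₁ ^ 2 - (34 / l + 40 / l * (p / n)) * l2norm Δ₂ ^ 2
        ≤ (1 / (n : ℝ)) * ∑ i, (u (T i ω) ⬝ᵥ w + z (T i ω) ⬝ᵥ (Δ₁ + Δ₂)) ^ 2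
          * bandIndicator η τ (T i ω)}ᶜ
      ⊆ (({ω | ∀ x y, |dev T ν (fun t => (u t ⬝ᵥ x) * (u t ⬝ᵥ y) * bandIndicator η τ t) ω|
            ≤ 4 * ε * (l2norm x * l2norm y)}ᶜ
          ∪ {ω | ∀ k j, |dev T ν (fun t => u t k * z t j * bandIndicator η τ t) ω| ≤ x₀}ᶜ)
          ∪ {ω | ∀ k j, |dev T ν (fun t => z t k * z t j * bandIndicator η τ t) ω| ≤ x₀}ᶜ)
          ∪ {ω | ∀ x y, |dev T ν (fun t => (z t ⬝ᵥ x) * (z t ⬝ᵥ y) * 1) ω|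
            ≤ 4 * (2 / l * (4 + 5 * (p / n))) * (l2norm x * l2norm y)}ᶜ := by
    rw [← Set.compl_inter, ← Set.compl_inter, ← Set.compl_inter, Set.compl_subset_compl]
    rintro ω ⟨⟨⟨h1, h2⟩, h3⟩, h4⟩ w Δ₁ hΔ Δ₂
    have := le_empirical_sq_add_mul_bandIndicator hl hu hz hη hκ hτ h8 hlow hε hx₀ hS hqS
      h1 h2 h3 h4 w hΔ Δ₂
    have e : 2 / l + 4 * (2 / l * (4 + 5 * ((p : ℝ) / n))) = 34 / l + 40 / l * (p / n) := by ring
    rwa [e] at this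
  calc _ ≤ _ := measureReal_mono hsub (measure_ne_top _ _)
    _ ≤ _ := measureReal_union_le _ _
    _ ≤ _ := add_le_add_left (measureReal_union_le _ _) _
    _ ≤ _ := add_le_add_left (add_le_add_left (measureReal_union_le _ _) _) _
    _ ≤ _ := by linarith

end Probability

/-! ### Choice of the thresholds and tail estimates. -/

section Numerics

lemma exp_neg_mul_nat_le {c : ℝ} (hc : 0 < c) (m : ℕ) {n : ℕ} (hn : 1 ≤ n) :
    Real.exp (-(n * c)) ≤ m.factorial / c ^ m * (n : ℝ) ^ (-(m : ℤ)) := by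
  have hn' : (0 : ℝ) < n := by exact_mod_cast hn
  have h := Real.pow_div_factorial_le_exp (n * c) (by positivity) m
  rw [Real.exp_neg, zpow_neg, zpow_natCast]
  have hf : (0 : ℝ) < m.factorial := by exact_mod_cast m.factorial_pos
  calc (Real.exp (n * c))⁻¹ ≤ ((n * c) ^ m / m.factorial)⁻¹ :=
        inv_anti₀ (by positivity) h
    _ = _ := by rw [mul_pow]; field_simp

/-- Half of the exponent pays for the net, the other half gives the polynomial decay. -/
lemma pow_mul_exp_neg_le {c : ℝ} (hc : 0 < c) (m : ℕ) {n q : ℕ} (hn : 1 ≤ n)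
    (hq : q * 4 ≤ n * (c / 2)) :
    (25 : ℝ) ^ q * (2 * Real.exp (-(n * c)))
      ≤ 2 * (m.factorial / (c / 2) ^ m * (n : ℝ) ^ (-(m : ℤ))) := by
  have h2 : (25 : ℝ) ^ q ≤ Real.exp (n * (c / 2)) := by
    calc (25 : ℝ) ^ q ≤ Real.exp 4 ^ q := by gcongr; exact twentyFive_le_exp_four
      _ = Real.exp (q * 4) := (Real.exp_nat_mul _ _).symm
      _ ≤ _ := Real.exp_le_exp.2 hq
  have h3 := exp_neg_mul_nat_le (half_pos hc) m hn
  have h4 : Real.exp (n * (c / 2)) * Real.exp (-(n * c)) = Real.exp (-(n * (c / 2))) := by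
    rw [← Real.exp_add]; congr 1; ring
  calc _ ≤ Real.exp (n * (c / 2)) * (2 * Real.exp (-(n * c))) := by gcongr
    _ = 2 * (Real.exp (n * (c / 2)) * Real.exp (-(n * c))) := by ring
    _ ≤ _ := by rw [h4]; gcongr

/-- Two of the `m + 2` powers of `p` pay for the union bound over the matrix entries. -/
lemma card_mul_exp_neg_log_le {A : ℝ} (m : ℕ) {p q : ℕ} (hp : 1 ≤ p) (hq : (q : ℝ) ≤ A * p) :
    ((q : ℝ) * p + p * p) * (2 * Real.exp (-(Real.log p * (m + 2))))
      ≤ 2 * (A + 1) * (p : ℝ) ^ (-(m : ℤ)) := by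
  have hp0 : (0 : ℝ) < p := by exact_mod_cast hp
  have e : Real.log p * ((m : ℝ) + 2) = ((m + 2 : ℕ) : ℝ) * Real.log p := by push_cast; ring
  rw [e, Real.exp_neg, Real.exp_nat_mul, Real.exp_log hp0, zpow_neg, zpow_natCast, pow_add]
  have h2 : ((q : ℝ) * p + p * p) ≤ (A + 1) * p ^ 2 := by
    nlinarith [mul_le_mul_of_nonneg_right hq hp0.le]
  calc ((q : ℝ) * p + p * p) * (2 * ((p : ℝ) ^ m * p ^ 2)⁻¹)
      ≤ ((A + 1) * p ^ 2) * (2 * ((p : ℝ) ^ m * p ^ 2)⁻¹) := by gcongr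
    _ = _ := by field_simp

/-- Choice of the threshold on `s √(log p / n)` and of the constant in the probability bound. -/
lemma exists_threshold {l κ B : ℝ} (hl : 0 < l) (hκ : 0 < κ) (hB : 0 < B) (C' : ℝ) (m : ℕ)
    {ε : ℝ} (hε : 0 < ε) :
    ∃ α c : ℝ, 0 < α ∧ 0 < c ∧ ∀ n p q s : ℕ, 1 ≤ n → 2 ≤ p → (n : ℝ) ≤ C' * p → 1 ≤ s →
      s * √(Real.log p / n) ≤ α → q * s * √(Real.log p / n) ≤ B →
      ∃ x₀ : ℝ, 0 ≤ x₀ ∧ x₀ * l ≤ 16 ∧ s * x₀ ≤ κ / 256 ∧ √q * √s * x₀ ≤ κ / 64 ∧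
        25 ^ q * (2 * Real.exp (-(n * (ε ^ 2 * l ^ 2 / 64))))
          + (q * p + p * p) * (2 * Real.exp (-(n * (x₀ ^ 2 * l ^ 2 / 64))))
          + 2 * Real.exp (-p) ≤ c * ((n : ℝ) ^ (-(m : ℤ)) + (p : ℝ) ^ (-(m : ℤ))) := by
  -- With `x₀ = K √(log p / n)` the entrywise exponent `n x₀² l² / 64` equals `(m + 2) log p`.
  set K : ℝ := 8 * √(m + 2) / l with hK
  have hKpos : 0 < K := by positivity
  have hK2 : K ^ 2 * l ^ 2 / 64 = m + 2 := by
    rw [hK, div_pow, mul_pow, Real.sq_sqrt (by positivity)]; field_simp; norm_num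
  set c₀ : ℝ := ε ^ 2 * l ^ 2 / 64 with hc₀
  have hc₀pos : 0 < c₀ := by positivity
  have hlog2 : 0 < Real.log 2 := Real.log_pos (by norm_num)
  -- The bounds serve, in order: `x₀ l ≤ 16`, the `ZZ` block, the `UZ` block, the net in `ℝ^q`, and
  -- `q ≤ n`.
  set α : ℝ := min (min (16 / (K * l)) (κ / 256 / K))
    (min ((κ / 64) ^ 2 / (B * K ^ 2)) (min (c₀ * Real.log 2 / (8 * B)) (Real.log 2 / B))) with hα
  have hαpos : 0 < α := by
    simp only [hα, lt_min_iff]; refine ⟨⟨?_, ?_⟩, ?_, ?_, ?_⟩ <;> positivity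
  have a1 : K * α * l ≤ 16 := by
    have : α ≤ 16 / (K * l) := (min_le_left _ _).trans (min_le_left _ _)
    rw [le_div_iff₀ (by positivity)] at this; linarith
  have a2 : α * K ≤ κ / 256 := by
    have : α ≤ κ / 256 / K := (min_le_left _ _).trans (min_le_right _ _)
    rwa [le_div_iff₀ (by positivity)] at this
  have a3 : α * (B * K ^ 2) ≤ (κ / 64) ^ 2 := by
    have : α ≤ (κ / 64) ^ 2 / (B * K ^ 2) := (min_le_right _ _).trans (min_le_left _ _)
    rwa [le_div_iff₀ (by positivity)] at this
  have a4 : α * (8 * B) ≤ c₀ * Real.log 2 := by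
    have : α ≤ c₀ * Real.log 2 / (8 * B) :=
      (min_le_right _ _).trans ((min_le_right _ _).trans (min_le_left _ _))
    rwa [le_div_iff₀ (by positivity)] at this
  have a5 : α * B ≤ Real.log 2 := by
    have : α ≤ Real.log 2 / B :=
      (min_le_right _ _).trans ((min_le_right _ _).trans (min_le_right _ _))
    rwa [le_div_iff₀ (by positivity)] at this
  set M₁ : ℝ := m.factorial / (c₀ / 2) ^ m with hM₁
  set M₂ : ℝ := m.factorial / (1 : ℝ) ^ m with hM₂
  have hM₁0 : 0 < M₁ := by positivity
  have hM₂0 : 0 < M₂ := by positivity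
  refine ⟨α, 2 * M₁ + 2 * (|C'| + 1) + 2 * M₂, hαpos, by positivity, ?_⟩
  intro n p q s hn hp hnp hs hsα hqs
  have hn' : (0 : ℝ) < n := by exact_mod_cast hn
  have hp' : (2 : ℝ) ≤ p := by exact_mod_cast hp
  have hp0 : (0 : ℝ) < p := by linarith
  have hs' : (1 : ℝ) ≤ s := by exact_mod_cast hs
  have hlogp : Real.log 2 ≤ Real.log p := Real.log_le_log (by norm_num) hp'
  set ρ := √(Real.log p / n) with hρ
  have hρ0 : 0 ≤ ρ := Real.sqrt_nonneg _
  have hρ2 : ρ ^ 2 = Real.log p / n := Real.sq_sqrt (by have := hlog2.le.trans hlogp; positivity)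
  have hρα : ρ ≤ α := (le_mul_of_one_le_left hρ0 hs').trans hsα
  have hq0 : (0 : ℝ) ≤ q := Nat.cast_nonneg q
  -- The product `q s ρ` is merely bounded; the spare factor `ρ ≤ α` makes `q s ρ²` small, and with
  -- it `q / n`.
  have hqρ : q * s * ρ ^ 2 ≤ B * α := by
    calc q * s * ρ ^ 2 = (q * s * ρ) * ρ := by ring
      _ ≤ B * α := by gcongr
  have hqn : q * Real.log 2 ≤ B * α * n := by
    have h1 : q * ρ ^ 2 ≤ B * α := by
      refine le_trans ?_ hqρ
      exact mul_le_mul_of_nonneg_right (le_mul_of_one_le_right hq0 hs') (sq_nonneg ρ)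
    rw [hρ2, ← mul_div_assoc, div_le_iff₀ hn'] at h1
    exact (mul_le_mul_of_nonneg_left hlogp hq0).trans h1
  refine ⟨K * ρ, by positivity, ?_, ?_, ?_, ?_⟩
  · calc K * ρ * l ≤ K * α * l := by gcongr
      _ ≤ 16 := a1
  · calc s * (K * ρ) = s * ρ * K := by ring
      _ ≤ α * K := by gcongr
      _ ≤ _ := a2
  · refine le_of_sq_le_sq ?_ (by positivity)
    calc (√q * √s * (K * ρ)) ^ 2 = (√q) ^ 2 * (√s) ^ 2 * ρ ^ 2 * K ^ 2 := by ring
      _ = q * s * ρ ^ 2 * K ^ 2 := by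
        rw [Real.sq_sqrt hq0, Real.sq_sqrt (Nat.cast_nonneg s)]
      _ ≤ B * α * K ^ 2 := by gcongr
      _ = α * (B * K ^ 2) := by ring
      _ ≤ _ := a3
  · have hnm : 0 < (n : ℝ) ^ (-(m : ℤ)) := by positivity
    have hpm : 0 < (p : ℝ) ^ (-(m : ℤ)) := by positivity
    have hqle : (q : ℝ) ≤ n := by
      have : q * Real.log 2 ≤ n * Real.log 2 := by
        linarith [mul_le_mul_of_nonneg_right a5 hn'.le]
      exact le_of_mul_le_mul_right this hlog2
    have hqC : (q : ℝ) ≤ |C'| * p :=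
      hqle.trans (hnp.trans (mul_le_mul_of_nonneg_right (le_abs_self _) hp0.le))
    have t1 : (25 : ℝ) ^ q * (2 * Real.exp (-(n * c₀))) ≤ 2 * (M₁ * (n : ℝ) ^ (-(m : ℤ))) := by
      refine pow_mul_exp_neg_le hc₀pos m hn (le_of_mul_le_mul_right ?_ hlog2)
      have := mul_le_mul_of_nonneg_right a4 hn'.le
      linarith
    have t2 : ((q : ℝ) * p + p * p) * (2 * Real.exp (-(n * ((K * ρ) ^ 2 * l ^ 2 / 64))))
        ≤ 2 * (|C'| + 1) * (p : ℝ) ^ (-(m : ℤ)) := by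
      have h1 : (n : ℝ) * ((K * ρ) ^ 2 * l ^ 2 / 64) = Real.log p * (m + 2) := by
        rw [mul_pow, hρ2]
        calc (n : ℝ) * (K ^ 2 * (Real.log p / n) * l ^ 2 / 64)
            = Real.log p * (K ^ 2 * l ^ 2 / 64) := by field_simp
          _ = _ := by rw [hK2]
      rw [h1]
      exact card_mul_exp_neg_log_le m (by omega) hqC
    have t3 : 2 * Real.exp (-(p : ℝ)) ≤ 2 * (M₂ * (p : ℝ) ^ (-(m : ℤ))) := by
      have := exp_neg_mul_nat_le one_pos m (show 1 ≤ p by omega)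
      rw [mul_one] at this
      linarith
    have hC0 := abs_nonneg C'
    nlinarith [mul_pos hM₁0 hpm, mul_pos hM₂0 hnm, mul_nonneg hC0 hnm.le]

end Numerics
-- Second moments in the confounded model.
lemma lambdaMin_mul_l2norm_sq_le {d : ℕ} {A : Matrix (Fin d) (Fin d) ℝ} (hA : A.IsHermitian)
    (v : Fin d → ℝ) : lambdaMin A * l2norm v ^ 2 ≤ v ⬝ᵥ (A *ᵥ v) := by
  have hfin : (spectrum ℝ A).Finite := Matrix.finite_real_spectrum
  have hpsd : (A - algebraMap ℝ _ (lambdaMin A)).PosSemidef := by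
    rw [Matrix.posSemidef_iff_isHermitian_and_spectrum_nonneg]
    refine ⟨hA.sub ?_, ?_⟩
    · rw [Matrix.algebraMap_eq_diagonal]
      exact Matrix.isHermitian_diagonal _
    · rw [← spectrum.sub_singleton_eq]
      rintro _ ⟨x, hx, y, rfl, rfl⟩
      exact sub_nonneg.2 (csInf_le hfin.bddBelow hx)
  have h := hpsd.dotProduct_mulVec_nonneg v
  rw [star_trivial, Algebra.algebraMap_eq_smul_one, Matrix.sub_mulVec, Matrix.smul_mulVec,
    Matrix.one_mulVec, dotProduct_sub, dotProduct_smul, smul_eq_mul,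
    ← l2norm_sq_eq_dotProduct] at h
  linarith

section Transfer

variable {Ω 𝒯 : Type*} [MeasurableSpace Ω] [MeasurableSpace 𝒯] {P : Measure Ω} {T : Ω → 𝒯}

lemma SqExpBound.map {l : ℝ} {A : 𝒯 → ℝ} (hT : Measurable T) (hA : Measurable A)
    (h : SqExpBound l (fun ω => A (T ω)) P) : SqExpBound l A (P.map T) := by
  have hm : AEStronglyMeasurable (fun t => Real.exp (l * A t ^ 2)) (P.map T) :=
    Measurable.aestronglyMeasurable (by fun_prop)
  refine ⟨hA, (integrable_map_measure hm hT.aemeasurable).2 h.integrable, ?_⟩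
  rw [integral_map hT.aemeasurable hm]
  exact h.integral_le

lemma integral_dotProduct_mul {d d' : ℕ} {a : Ω → Fin d → ℝ} {a' : Ω → Fin d' → ℝ}
    (hi : ∀ k j, Integrable (fun ω => a ω k * a' ω j) P) (x : Fin d → ℝ) (y : Fin d' → ℝ) :
    ∫ ω, (a ω ⬝ᵥ x) * (a' ω ⬝ᵥ y) ∂P = ∑ k, ∑ j, x k * (y j * ∫ ω, a ω k * a' ω j ∂P) := by
  have e : (fun ω => (a ω ⬝ᵥ x) * (a' ω ⬝ᵥ y))
      = fun ω => ∑ k, ∑ j, (x k * y j) * (a ω k * a' ω j) := by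
    funext ω
    rw [dotProduct, dotProduct, Finset.sum_mul_sum]
    refine Finset.sum_congr rfl fun k _ => Finset.sum_congr rfl fun j _ => ?_
    ring
  rw [e, integral_finsetSum _ fun k _ => integrable_finsetSum _ fun j _ => (hi k j).const_mul _]
  refine Finset.sum_congr rfl fun k _ => ?_
  rw [integral_finsetSum _ fun j _ => (hi k j).const_mul _]
  refine Finset.sum_congr rfl fun j _ => ?_
  rw [integral_const_mul]; ring

variable [IsProbabilityMeasure P]

lemma SqExpBound.dotProduct_of_hasSubgaussianMGF {d : ℕ} {a : Ω → Fin d → ℝ} (ha : Measurable a)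
    {c : ℝ≥0} (h : ∀ x, l2norm x = 1 → HasSubgaussianMGF (fun ω => a ω ⬝ᵥ x) c P) {l : ℝ}
    (hl : 0 ≤ l) (hlc : l * c ≤ 1 / 4) (x : Fin d → ℝ) (hx : l2norm x ≤ 1) :
    SqExpBound l (fun ω => a ω ⬝ᵥ x) P := by
  have hm : ∀ y : Fin d → ℝ, Measurable fun ω => a ω ⬝ᵥ y := fun y => by
    unfold dotProduct; fun_prop
  obtain ⟨y, hy, e⟩ := exists_eq_l2norm_smul x
  by_cases h0 : l2norm x = 0
  · have hx0 : x = 0 := by rw [e, h0, zero_smul]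
    subst hx0
    refine ⟨hm 0, by simp, by simp⟩
  · have hpos := (l2norm_nonneg x).lt_of_ne' h0
    have hy1 : l2norm ((l2norm x)⁻¹ • x) = 1 := by
      rw [l2norm_smul, abs_inv, abs_of_pos hpos, inv_mul_cancel₀ h0]
    refine (SqExpBound.of_hasSubgaussianMGF (hm _) (h _ hy1) hl hlc).of_le (hm x) fun ω => ?_
    refine mul_le_mul_of_nonneg_left ?_ hl
    rw [dotProduct_smul, smul_eq_mul, mul_pow]
    refine le_mul_of_one_le_left (sq_nonneg _) ?_
    rw [inv_pow]
    exact one_le_inv_iff₀.2 ⟨by positivity, pow_le_one₀ hpos.le hx⟩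

end Transfer

section Model

variable {Ω₀ : Type*} [MeasurableSpace Ω₀] {P₀ : Measure Ω₀} [IsProbabilityMeasure P₀]
  {p q : ℕ} {θ : Params p q} {V₀ : RandVars Ω₀ p q} {σz σu σε σx ση : ℝ≥0} {Cδ l : ℝ}

/-- Separates the confounded direction `Γ Δ` from `Δ`, so that the two can be treated as unrelated
vectors. -/
lemma dotProduct_X {x z : Fin p → ℝ} {u : Fin q → ℝ} (h : x = θ.Γᵀ *ᵥ u + z) (Δ : Fin p → ℝ) :
    x ⬝ᵥ Δ = u ⬝ᵥ (θ.Γ *ᵥ Δ) + z ⬝ᵥ Δ := by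
  rw [h, add_dotProduct, Matrix.mulVec_transpose, Matrix.dotProduct_mulVec]

lemma SubGaussianAssumption.sqExpBound_U
    (hS : SubGaussianAssumption σz σu σε σx ση Cδ θ V₀ P₀) (hM : IsConfoundedModel θ V₀ P₀)
    (hl : 0 ≤ l) (h : l * σu ^ 2 ≤ 1 / 4) (x : Fin q → ℝ) (hx : l2norm x ≤ 1) :
    SqExpBound l (fun ω => V₀.U ω ⬝ᵥ x) P₀ :=
  SqExpBound.dotProduct_of_hasSubgaussianMGF hM.measurable_U hS.subG_U hl (by simpa using h) x hx

lemma SubGaussianAssumption.sqExpBound_Z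
    (hS : SubGaussianAssumption σz σu σε σx ση Cδ θ V₀ P₀) (hM : IsConfoundedModel θ V₀ P₀)
    (hl : 0 ≤ l) (h : l * σz ^ 2 ≤ 1 / 4) (x : Fin p → ℝ) (hx : l2norm x ≤ 1) :
    SqExpBound l (fun ω => V₀.Z ω ⬝ᵥ x) P₀ :=
  SqExpBound.dotProduct_of_hasSubgaussianMGF hM.measurable_Z hS.subG_Z hl (by simpa using h) x hx

/-- The confounders are uncorrelated with `Z` and isotropic. -/
lemma SubGaussianAssumption.integral_sq_eq
    (hS : SubGaussianAssumption σz σu σε σx ση Cδ θ V₀ P₀) (hM : IsConfoundedModel θ V₀ P₀)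
    (hl : 0 < l) (hz : l * σz ^ 2 ≤ 1 / 4) (hu : l * σu ^ 2 ≤ 1 / 4)
    (w : Fin q → ℝ) (Δ : Fin p → ℝ) :
    ∫ ω, (V₀.U ω ⬝ᵥ w + V₀.Z ω ⬝ᵥ Δ) ^ 2 ∂P₀
      = l2norm w ^ 2 + ∫ ω, (V₀.Z ω ⬝ᵥ Δ) ^ 2 ∂P₀ := by
  have bU := hS.sqExpBound_U hM hl.le hu
  have bZ := hS.sqExpBound_Z hM hl.le hz
  have iUU : ∀ x y, Integrable (fun ω => (V₀.U ω ⬝ᵥ x) * (V₀.U ω ⬝ᵥ y)) P₀ := fun x y => by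
    simpa using integrable_dotProduct_mul hl bU bU (b := fun _ => 1) measurable_const (by simp) x y
  have iUZ : ∀ x y, Integrable (fun ω => (V₀.U ω ⬝ᵥ x) * (V₀.Z ω ⬝ᵥ y)) P₀ := fun x y => by
    simpa using integrable_dotProduct_mul hl bU bZ (b := fun _ => 1) measurable_const (by simp) x y
  have iZZ : ∀ x y, Integrable (fun ω => (V₀.Z ω ⬝ᵥ x) * (V₀.Z ω ⬝ᵥ y)) P₀ := fun x y => by
    simpa using integrable_dotProduct_mul hl bZ bZ (b := fun _ => 1) measurable_const (by simp) x y
  have hUU : ∫ ω, (V₀.U ω ⬝ᵥ w) * (V₀.U ω ⬝ᵥ w) ∂P₀ = l2norm w ^ 2 := by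
    rw [integral_dotProduct_mul fun k j => by simpa using iUU (Pi.single k 1) (Pi.single j 1),
      l2norm_sq]
    refine Finset.sum_congr rfl fun k _ => ?_
    have hcov : ∀ j, ∫ ω, V₀.U ω k * V₀.U ω j ∂P₀ = (1 : Matrix (Fin q) (Fin q) ℝ) k j := by
      intro j
      rw [← hS.var_U]
      simp only [RandVars.varU, Matrix.of_apply, covariance, hS.mean_U, sub_zero]
    simp_rw [hcov, Matrix.one_apply]
    simp [sq]
  have hUZ : ∫ ω, (V₀.U ω ⬝ᵥ w) * (V₀.Z ω ⬝ᵥ Δ) ∂P₀ = 0 := by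
    rw [integral_dotProduct_mul fun k j => by simpa using iUZ (Pi.single k 1) (Pi.single j 1)]
    refine Finset.sum_eq_zero fun k _ => Finset.sum_eq_zero fun j _ => ?_
    have hind : IndepFun (fun ω => V₀.U ω k) (fun ω => V₀.Z ω j) P₀ :=
      hM.indep_Z_U.symm.comp (measurable_pi_apply k) (measurable_pi_apply j)
    have h0 : ∫ ω, V₀.U ω k * V₀.Z ω j ∂P₀ = 0 := by
      have := hind.integral_fun_mul_eq_mul_integral
        (measurable_pi_iff.1 hM.measurable_U k).aestronglyMeasurable
        (measurable_pi_iff.1 hM.measurable_Z j).aestronglyMeasurable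
      rw [this, hM.mean_Z, mul_zero]
    rw [h0]; ring
  have e : (fun ω => (V₀.U ω ⬝ᵥ w + V₀.Z ω ⬝ᵥ Δ) ^ 2)
      = fun ω => ((V₀.U ω ⬝ᵥ w) * (V₀.U ω ⬝ᵥ w) + 2 * ((V₀.U ω ⬝ᵥ w) * (V₀.Z ω ⬝ᵥ Δ)))
        + (V₀.Z ω ⬝ᵥ Δ) * (V₀.Z ω ⬝ᵥ Δ) := by
    funext ω; ring
  have i1 : Integrable (fun ω => (V₀.U ω ⬝ᵥ w) * (V₀.U ω ⬝ᵥ w)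
      + 2 * ((V₀.U ω ⬝ᵥ w) * (V₀.Z ω ⬝ᵥ Δ))) P₀ := (iUU w w).add ((iUZ w Δ).const_mul 2)
  rw [e, integral_add i1 (iZZ Δ Δ), integral_add (iUU w w) ((iUZ w Δ).const_mul 2),
    integral_const_mul, hUU, hUZ]
  simp only [mul_zero, add_zero, sq]

lemma SubGaussianAssumption.le_integral_sq
    (hS : SubGaussianAssumption σz σu σε σx ση Cδ θ V₀ P₀) (hM : IsConfoundedModel θ V₀ P₀)
    (hl : 0 < l) (hz : l * σz ^ 2 ≤ 1 / 4) (hu : l * σu ^ 2 ≤ 1 / 4) {cz : ℝ}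
    (hcz : cz ≤ lambdaMin (V₀.secondMomentZ P₀)) (w : Fin q → ℝ) (Δ : Fin p → ℝ) :
    min 1 cz * (l2norm w ^ 2 + l2norm Δ ^ 2)
      ≤ ∫ ω, (V₀.U ω ⬝ᵥ w + V₀.Z ω ⬝ᵥ Δ) ^ 2 ∂P₀ := by
  rw [hS.integral_sq_eq hM hl hz hu]
  have bZ := hS.sqExpBound_Z hM hl.le hz
  have iZZ : ∀ k j, Integrable (fun ω => V₀.Z ω k * V₀.Z ω j) P₀ := fun k j => by
    simpa using integrable_dotProduct_mul hl bZ bZ (b := fun _ => 1) measurable_const (by simp)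
      (Pi.single k 1) (Pi.single j 1)
  have hherm : (V₀.secondMomentZ P₀).IsHermitian := by
    ext k j
    simp [RandVars.secondMomentZ, mul_comm]
  have h := lambdaMin_mul_l2norm_sq_le hherm Δ
  have e : Δ ⬝ᵥ (V₀.secondMomentZ P₀ *ᵥ Δ) = ∫ ω, (V₀.Z ω ⬝ᵥ Δ) ^ 2 ∂P₀ := by
    simp_rw [sq]
    rw [integral_dotProduct_mul iZZ, dotProduct]
    refine Finset.sum_congr rfl fun k _ => ?_
    rw [Matrix.mulVec, dotProduct, Finset.mul_sum]
    refine Finset.sum_congr rfl fun j _ => ?_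
    simp only [RandVars.secondMomentZ, Matrix.of_apply]
    ring
  rw [← e]
  have h1 := mul_le_mul_of_nonneg_right (min_le_left 1 cz) (sq_nonneg (l2norm w))
  have h2 := mul_le_mul_of_nonneg_right ((min_le_right 1 cz).trans hcz) (sq_nonneg (l2norm Δ))
  linarith

/-- The confounding strength is limited by the variances of the treatments. -/
lemma SubGaussianAssumption.card_mul_rl_le
    (hS : SubGaussianAssumption σz σu σε σx ση Cδ θ V₀ P₀) (hM : IsConfoundedModel θ V₀ P₀)
    (hσx : 0 < σx) (hl : 0 < l) (hz : l * σz ^ 2 ≤ 1 / 4) (hu : l * σu ^ 2 ≤ 1 / 4) :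
    q * θ.rl ≤ p * (8 * (σx : ℝ) ^ 2) := by
  have hσ : (0 : ℝ) < σx := by exact_mod_cast hσx
  have hmX : ∀ j, Measurable fun ω => V₀.X ω j := by
    intro j
    have h1 := hM.measurable_U
    have h2 := hM.measurable_Z
    have e : (fun ω => V₀.X ω j) = fun ω => ∑ k, θ.Γ k j * V₀.U ω k + V₀.Z ω j := by
      funext ω
      rw [hM.X_eq]
      simp [Matrix.mulVec, dotProduct]
    rw [e]
    fun_prop
  -- The trace of `Γ Γᵀ` is counted twice: column `j` contributes at most `E X_j² ≤ 8 σx²`, while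
  -- each diagonal entry is at least the smallest eigenvalue.
  have hcol : ∀ j, ∑ k, θ.Γ k j ^ 2 ≤ 8 * (σx : ℝ) ^ 2 := by
    intro j
    have b := SqExpBound.of_hasSubgaussianMGF (hmX j) (hS.subG_X j)
      (l := 1 / (4 * (σx : ℝ) ^ 2)) (by positivity) (by push_cast; field_simp; rfl)
    have h1 := (b.integral_sq_le (by positivity)).2
    have h2 := hS.integral_sq_eq hM hl hz hu (θ.Γ *ᵥ Pi.single j 1) (Pi.single j 1)
    simp_rw [← dotProduct_X (hM.X_eq _)] at h2
    have h3 : 0 ≤ ∫ ω, (V₀.Z ω ⬝ᵥ Pi.single j 1) ^ 2 ∂P₀ := integral_nonneg fun ω => sq_nonneg _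
    rw [l2norm_sq] at h2
    simp only [dotProduct_single, mul_one, Matrix.mulVec_single_one, Matrix.col_apply] at h2 h3
    have h4 : 2 / (1 / (4 * (σx : ℝ) ^ 2)) = 8 * (σx : ℝ) ^ 2 := by field_simp; norm_num
    rw [h4] at h1
    linarith
  have hrow : ∀ k, θ.rl ≤ ∑ j, θ.Γ k j ^ 2 := by
    intro k
    have h := lambdaMin_mul_l2norm_sq_le
      (A := θ.Γ * θ.Γᵀ) (by simpa using Matrix.isHermitian_mul_conjTranspose_self θ.Γ)
      (Pi.single k 1)
    rw [l2norm_single] at h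
    simp only [one_pow, mul_one, Matrix.mulVec_single_one, single_dotProduct, Matrix.col_apply,
      one_mul] at h
    refine h.trans (le_of_eq ?_)
    simp [Matrix.mul_apply, sq]
  calc q * θ.rl = ∑ _k : Fin q, θ.rl := by simp
    _ ≤ ∑ k, ∑ j, θ.Γ k j ^ 2 := Finset.sum_le_sum fun k _ => hrow k
    _ = ∑ j, ∑ k, θ.Γ k j ^ 2 := Finset.sum_comm
    _ ≤ ∑ _j : Fin p, 8 * (σx : ℝ) ^ 2 := Finset.sum_le_sum fun j _ => hcol j
    _ = _ := by simp

end Model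
-- Assembly of the theorem.
lemma le_measureReal_goodEvent {Ω₀ Ω : Type*} [MeasurableSpace Ω₀] {P₀ : Measure Ω₀}
    [IsProbabilityMeasure P₀] [MeasurableSpace Ω] {P : Measure Ω} [IsProbabilityMeasure P]
    {n p q : ℕ} {θ : Params p q} {V₀ : RandVars Ω₀ p q} {V : Fin n → RandVars Ω p q}
    {σz σu σε σx ση : ℝ≥0} {Cδ l cz : ℝ} (hn : 1 ≤ n) (hM : IsConfoundedModel θ V₀ P₀)
    (hS : SubGaussianAssumption σz σu σε σx ση Cδ θ V₀ P₀) (hV : IsIIDSample V₀ P₀ V P)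
    (hcz0 : 0 < cz) (hcz : cz ≤ lambdaMin (V₀.secondMomentZ P₀))
    (hl : 0 < l) (hz : l * σz ^ 2 ≤ 1 / 4) (hu : l * σu ^ 2 ≤ 1 / 4) (hη : l * ση ^ 2 ≤ 1 / 4)
    {τ : ℝ} (hτ : 0 < τ) (h8 : 128 ≤ (min 1 cz) ^ 2 * l ^ 3 * τ ^ 2)
    {x₀ ε : ℝ} (hx₀ : 0 ≤ x₀) (hx₀l : x₀ * l ≤ 16)
    (hε0 : 0 ≤ ε) (hε : ε ≤ min 1 cz / 64) (hεl : ε * l ≤ 16)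
    (hs : θ.s * x₀ ≤ min 1 cz / 256) (hqs : √q * √θ.s * x₀ ≤ min 1 cz / 64) {cp : ℝ}
    (hcp : 34 / l + 40 / l * (p / n) ≤ cp * θ.rl * √(Real.log p / n)) :
    1 - (25 ^ q * (2 * Real.exp (-(n * (ε ^ 2 * l ^ 2 / 64))))
        + (q * p + p * p) * (2 * Real.exp (-(n * (x₀ ^ 2 * l ^ 2 / 64))))
        + 2 * Real.exp (-p))
      ≤ P.real (goodEvent θ V τ (min 1 cz / 8) cp) := by
  let T₀ : Ω₀ → (Fin p → ℝ) × (Fin q → ℝ) := fun ω => (V₀.Z ω, V₀.U ω)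
  let T : Fin n → Ω → (Fin p → ℝ) × (Fin q → ℝ) := fun i ω => ((V i).Z ω, (V i).U ω)
  let ν := P₀.map T₀
  let η : (Fin p → ℝ) × (Fin q → ℝ) → ℝ := fun t => θ.eta (θ.Γᵀ *ᵥ t.2 + t.1) t.2
  have hT₀ : Measurable T₀ := hM.measurable_Z.prodMk hM.measurable_U
  have : IsProbabilityMeasure ν := Measure.isProbabilityMeasure_map hT₀.aemeasurable
  have hηm : Measurable η := by
    simp only [η, Params.eta, dotProduct, Matrix.mulVec, Pi.add_apply]
    fun_prop
  let π : ℝ × (Fin p → ℝ) × (Fin q → ℝ) × (Fin p → ℝ) × ℝ → (Fin p → ℝ) × (Fin q → ℝ) :=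
    fun t => (t.2.2.2.1, t.2.2.1)
  have hπ : Measurable π := by fun_prop
  have hind : iIndepFun T P := hV.indep.comp (fun _ => π) fun _ => hπ
  have hid : ∀ i, IdentDistrib (T i) id P ν := fun i =>
    ((hV.identDistrib i).comp hπ).trans
      ⟨hT₀.aemeasurable, aemeasurable_id, by rw [Measure.map_id]; rfl⟩
  -- The equation for `X` is assumed for the population tuple; the copies inherit it only almost
  -- surely, through their law.
  have hX : ∀ᵐ ω ∂P, ∀ i, (V i).X ω = θ.Γᵀ *ᵥ (V i).U ω + (V i).Z ω := by
    refine ae_all_iff.2 fun i => ?_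
    have hm : MeasurableSet {t : ℝ × (Fin p → ℝ) × (Fin q → ℝ) × (Fin p → ℝ) × ℝ |
        t.2.1 = θ.Γᵀ *ᵥ t.2.2.1 + t.2.2.2.1} := by
      refine measurableSet_eq_fun (by fun_prop) ?_
      refine measurable_pi_iff.2 fun j => ?_
      simp only [Matrix.mulVec, dotProduct, Pi.add_apply]
      fun_prop
    exact (hV.identDistrib i).symm.ae_snd hm (Eventually.of_forall hM.X_eq)
  have hdot : ∀ {d : ℕ} (y : Fin d → ℝ), Measurable fun v : Fin d → ℝ => v ⬝ᵥ y := fun y => by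
    unfold dotProduct; fun_prop
  have bU : ∀ x, l2norm x ≤ 1 → SqExpBound l
      (fun t : (Fin p → ℝ) × (Fin q → ℝ) => t.2 ⬝ᵥ x) ν := fun x hx =>
    (hS.sqExpBound_U hM hl.le hu x hx).map hT₀ ((hdot x).comp measurable_snd)
  have bZ : ∀ x, l2norm x ≤ 1 → SqExpBound l
      (fun t : (Fin p → ℝ) × (Fin q → ℝ) => t.1 ⬝ᵥ x) ν := fun x hx =>
    (hS.sqExpBound_Z hM hl.le hz x hx).map hT₀ ((hdot x).comp measurable_fst)
  have hηX : ∀ ω, η (T₀ ω) = θ.eta (V₀.X ω) (V₀.U ω) := fun ω => by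
    simp only [η, T₀, ← hM.X_eq]
  have bη : SqExpBound l η ν := by
    refine SqExpBound.map hT₀ hηm (SqExpBound.of_hasSubgaussianMGF (hηm.comp hT₀) ?_ hl.le
      (c := ση ^ 2) (by simpa using hη))
    exact hS.subG_eta.congr (Eventually.of_forall fun ω => (hηX ω).symm)
  have hlow : ∀ (x : Fin q → ℝ) (y : Fin p → ℝ), min 1 cz * (l2norm x ^ 2 + l2norm y ^ 2)
      ≤ ∫ t, (t.2 ⬝ᵥ x + t.1 ⬝ᵥ y) ^ 2 ∂ν := by
    intro x y
    have hm : Measurable fun t : (Fin p → ℝ) × (Fin q → ℝ) => (t.2 ⬝ᵥ x + t.1 ⬝ᵥ y) ^ 2 :=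
      (((hdot x).comp measurable_snd).add ((hdot y).comp measurable_fst)).pow_const 2
    rw [integral_map hT₀.aemeasurable hm.aestronglyMeasurable]
    exact hS.le_integral_sq hM hl hz hu hcz x y
  have hmain := measure_compl_empirical_lower_bound_le hn hind hid hl bU bZ bη
    (lt_min one_pos hcz0) hτ h8 hlow (S := θ.S) hx₀ hx₀l hε0 hε hεl hs hqs
  set E := {ω | ∀ w : Fin q → ℝ, ∀ Δ₁ ∈ cone θ.S, ∀ Δ₂ : Fin p → ℝ,
      min 1 cz / 8 * l2norm Δ₁ ^ 2 - (34 / l + 40 / l * (p / n)) * l2norm Δ₂ ^ 2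
        ≤ (1 / (n : ℝ)) * ∑ i, ((T i ω).2 ⬝ᵥ w + (T i ω).1 ⬝ᵥ (Δ₁ + Δ₂)) ^ 2
          * bandIndicator η τ (T i ω)} with hE
  have hsub : (goodEvent θ V τ (min 1 cz / 8) cp)ᶜ
      ⊆ Eᶜ ∪ {ω | ¬ ∀ i, (V i).X ω = θ.Γᵀ *ᵥ (V i).U ω + (V i).Z ω} := by
    intro ω hω
    by_contra hcon
    simp only [Set.mem_union, Set.mem_compl_iff, Set.mem_ofPred_eq, not_or, not_not] at hcon
    obtain ⟨hωE, hωX⟩ := hcon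
    refine hω fun Δ₁ hΔ Δ₂ => ?_
    -- This choice of `w` absorbs the whole confounding part, including `Γ Δ₂`, which therefore
    -- never counts as a perturbation.
    have h := hωE (θ.Γ *ᵥ (Δ₁ + Δ₂)) Δ₁ hΔ Δ₂
    have h1 := mul_le_mul_of_nonneg_right hcp (sq_nonneg (l2norm Δ₂))
    have h2 : ∀ i, ((T i ω).2 ⬝ᵥ (θ.Γ *ᵥ (Δ₁ + Δ₂)) + (T i ω).1 ⬝ᵥ (Δ₁ + Δ₂)) ^ 2
          * bandIndicator η τ (T i ω)
        = ((V i).X ω ⬝ᵥ (Δ₁ + Δ₂)) ^ 2 *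
          Set.indicator {ω' | |θ.eta ((V i).X ω') ((V i).U ω')| ≤ τ} (fun _ => (1 : ℝ)) ω := by
      intro i
      rw [dotProduct_X (hωX i)]
      congr 1
      have : η (T i ω) = θ.eta ((V i).X ω) ((V i).U ω) := by simp only [η, T, ← hωX i]
      simp only [bandIndicator, Set.indicator, Set.mem_ofPred_eq, this]
    simp_rw [h2] at h
    linarith
  have hnull : P.real {ω | ¬ ∀ i, (V i).X ω = θ.Γᵀ *ᵥ (V i).U ω + (V i).Z ω} = 0 := by
    rw [Measure.real, ae_iff.1 hX, ENNReal.toReal_zero]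
  have h1 := measureReal_mono hsub (measure_ne_top P _)
  have h2 := measureReal_union_le (μ := P) Eᶜ
    {ω | ¬ ∀ i, (V i).X ω = θ.Γᵀ *ᵥ (V i).U ω + (V i).Z ω}
  -- Subadditivity gives the lower bound without measurability of the good event, an uncountable
  -- intersection.
  have h3 := measureReal_union_le (μ := P) (goodEvent θ V τ (min 1 cz / 8) cp)
    (goodEvent θ V τ (min 1 cz / 8) cp)ᶜ
  rw [Set.union_compl_self, probReal_univ] at h3
  linarith

/-- With empty support the cone is `{0}` and the lower bound is nonpositive. -/
lemma goodEvent_eq_univ_of_s_eq_zero {Ω : Type*} {n p q : ℕ} {θ : Params p q}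
    (V : Fin n → RandVars Ω p q) {τ κ cp : ℝ} (hcp : 0 ≤ cp) (hrl : 0 ≤ θ.rl) (hs : θ.s = 0) :
    goodEvent θ V τ κ cp = Set.univ := by
  refine Set.eq_univ_of_forall fun ω Δ₁ hΔ Δ₂ => ?_
  have hS : θ.S = ∅ := Finset.card_eq_zero.1 hs
  have h0 : l2norm Δ₁ ^ 2 = 0 := by
    have h : ∑ j ∈ θ.Sᶜ, |Δ₁ j| ≤ 3 * ∑ j ∈ θ.S, |Δ₁ j| := hΔ
    rw [hS, Finset.compl_empty, Finset.sum_empty, mul_zero] at h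
    rw [l2norm_sq]
    refine Finset.sum_eq_zero fun j hj => ?_
    have := (Finset.sum_eq_zero_iff_of_nonneg fun j _ => abs_nonneg (Δ₁ j)).1
      (le_antisymm h (Finset.sum_nonneg fun j _ => abs_nonneg _)) j hj
    rw [abs_eq_zero.1 this]; norm_num
  rw [h0, mul_zero]
  have h1 : 0 ≤ cp * θ.rl * √(Real.log p / n) * l2norm Δ₂ ^ 2 := by positivity
  refine le_trans (by linarith) (mul_nonneg (by positivity) (Finset.sum_nonneg fun i _ =>
    mul_nonneg (sq_nonneg _) (Set.indicator_nonneg (fun _ _ => zero_le_one) _)))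

/-- The constants `κ, c_p, τ, c` depend only on `m` and on the constants (and the null
sequence `a`) that appear in the assumptions, not on `n`, `p`, `q`, the parameters of the
model or the distribution. -/
theorem theorem5
    (cz : ℝ) (hcz : 0 < cz)
    (σz σu σε σx ση : ℝ≥0) (hσz : 0 < σz) (hσu : 0 < σu) (hσε : 0 < σε) (hσx : 0 < σx)
    (hση : 0 < ση)
    (Cδ : ℝ) (a : ℕ → ℝ) (ha : Tendsto a atTop (𝓝 0)) (C : ℝ) (C' : ℝ) (m : ℕ) :
    ∃ κ cp τ c : ℝ, 0 < κ ∧ 0 < cp ∧ 0 < τ ∧ 0 < c ∧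
      ∀ (n p q : ℕ), 1 ≤ n → 1 ≤ q → (n : ℝ) ≤ C' * p →
      ∀ (Ω₀ : Type*) [MeasurableSpace Ω₀] (P₀ : Measure Ω₀) [IsProbabilityMeasure P₀]
        (Ω : Type*) [MeasurableSpace Ω] (P : Measure Ω) [IsProbabilityMeasure P]
        (θ : Params p q) (V₀ : RandVars Ω₀ p q) (V : Fin n → RandVars Ω p q),
        IsConfoundedModel θ V₀ P₀ →
        SubGaussianAssumption σz σu σε σx ση Cδ θ V₀ P₀ →
        IsIIDSample V₀ P₀ V P →
        cz ≤ lambdaMin (V₀.secondMomentZ P₀) →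
        0 < θ.rl →
        (θ.s : ℝ) * √(Real.log p / n) ≤ a n →
        ((θ.s : ℝ) * p / θ.rl) * √(Real.log p / n) ≤ C →
        1 - c * ((n : ℝ) ^ (-(m : ℤ)) + (p : ℝ) ^ (-(m : ℤ)))
          ≤ P.real (goodEvent θ V τ κ cp) := by
  have hσz' : (0 : ℝ) < σz := by exact_mod_cast hσz
  have hσx' : (0 : ℝ) < σx := by exact_mod_cast hσx
  have hκ : 0 < min 1 cz := lt_min one_pos hcz
  obtain ⟨l, hl, hlz, hlu, hlη⟩ : ∃ l : ℝ, 0 < l ∧ l * σz ^ 2 ≤ 1 / 4 ∧ l * σu ^ 2 ≤ 1 / 4 ∧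
      l * ση ^ 2 ≤ 1 / 4 := by
    refine ⟨1 / (4 * ((σz : ℝ) ^ 2 + σu ^ 2 + ση ^ 2)), by positivity, ?_, ?_, ?_⟩ <;>
    · rw [div_mul_eq_mul_div, one_mul, div_le_div_iff₀ (by positivity) (by norm_num)]
      nlinarith [sq_nonneg (σz : ℝ), sq_nonneg (σu : ℝ), sq_nonneg (ση : ℝ)]
  obtain ⟨ε, hε0, hε, hεl⟩ : ∃ ε : ℝ, 0 < ε ∧ ε ≤ min 1 cz / 64 ∧ ε * l ≤ 16 := by
    refine ⟨min (min 1 cz / 64) (16 / l), by positivity, min_le_left _ _, ?_⟩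
    exact (le_div_iff₀ hl).1 (min_le_right _ _)
  obtain ⟨τ, hτ, h8⟩ : ∃ τ : ℝ, 0 < τ ∧ 128 ≤ (min 1 cz) ^ 2 * l ^ 3 * τ ^ 2 := by
    refine ⟨√(128 / ((min 1 cz) ^ 2 * l ^ 3)), by positivity, ?_⟩
    rw [Real.sq_sqrt (by positivity)]
    exact (mul_div_cancel₀ _ (by positivity)).ge
  -- `B` bounds `q s √(log p / n)` through the trace inequality; the `1` keeps it positive.
  obtain ⟨α, c, hα, hc, hthr⟩ := exists_threshold hl hκ
    (B := |C| * (8 * (σx : ℝ) ^ 2) + 1) (by positivity) C' m hε0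
  obtain ⟨n₀, hn₀⟩ := eventually_atTop.1 (ha.eventually (ge_mem_nhds hα))
  have hlog2 : 0 < Real.log 2 := Real.log_pos (by norm_num)
  have hcp : 0 < (34 * |C'| + 40) / (l * Real.log 2) * (|C| + 1) := by positivity
  -- The terms `n₀ ^ m` and `1` added to `c` make the claim void for `n < n₀` and for `p = 1`, where
  -- `log p` vanishes.
  refine ⟨min 1 cz / 8, (34 * |C'| + 40) / (l * Real.log 2) * (|C| + 1), τ, c + n₀ ^ m + 1,
    by positivity, hcp, hτ, by positivity, ?_⟩
  intro n p q hn hq hnp Ω₀ _ P₀ _ Ω _ P _ θ V₀ V hM hS hV hczle hrl hsa hsC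
  have hn' : (0 : ℝ) < n := by exact_mod_cast hn
  have hnm : 0 < (n : ℝ) ^ (-(m : ℤ)) := by positivity
  have hpm : 0 ≤ (p : ℝ) ^ (-(m : ℤ)) := by positivity
  have hn₀m : (0 : ℝ) ≤ (n₀ : ℝ) ^ m := by positivity
  rcases Nat.eq_zero_or_pos θ.s with hs0 | hs1
  · rw [goodEvent_eq_univ_of_s_eq_zero V hcp.le hrl.le hs0, probReal_univ]
    have : 0 ≤ (c + n₀ ^ m + 1) * ((n : ℝ) ^ (-(m : ℤ)) + (p : ℝ) ^ (-(m : ℤ))) := by positivity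
    linarith
  have hp1 : 1 ≤ p := by
    rcases Nat.eq_zero_or_pos p with rfl | h
    · simp only [Nat.cast_zero, mul_zero] at hnp; linarith
    · exact h
  have hp0 : (0 : ℝ) < p := by exact_mod_cast hp1
  by_cases hsmall : n < n₀ ∨ p = 1
  · have h1 : 1 ≤ (c + n₀ ^ m + 1) * ((n : ℝ) ^ (-(m : ℤ)) + (p : ℝ) ^ (-(m : ℤ))) := by
      rcases hsmall with h | rfl
      · have hle : (n : ℝ) ^ m ≤ (n₀ : ℝ) ^ m := by gcongr
        have h2 : 1 ≤ (n₀ : ℝ) ^ m * (n : ℝ) ^ (-(m : ℤ)) := by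
          rw [zpow_neg, zpow_natCast, ← div_eq_mul_inv, one_le_div (by positivity)]
          exact hle
        nlinarith [mul_nonneg hc.le hnm.le, mul_nonneg hc.le hpm, mul_nonneg hn₀m hpm]
      · simp only [Nat.cast_one, one_zpow]
        nlinarith [mul_nonneg hc.le hnm.le, mul_nonneg hn₀m hnm.le]
    exact (sub_nonpos.2 h1).trans measureReal_nonneg
  push Not at hsmall
  have hp2 : 2 ≤ p := by omega
  have hs' : (1 : ℝ) ≤ θ.s := by exact_mod_cast hs1
  set ρ := √(Real.log p / n) with hρ
  have hρ0 : 0 ≤ ρ := Real.sqrt_nonneg _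
  have hlogp : Real.log 2 ≤ Real.log p := Real.log_le_log (by norm_num) (by exact_mod_cast hp2)
  have hρ2 : ρ ^ 2 = Real.log p / n := Real.sq_sqrt (by have := hlog2.le.trans hlogp; positivity)
  have hspρ : θ.s * p * ρ ≤ |C| * θ.rl := by
    have h := hsC.trans (le_abs_self C)
    rwa [div_mul_eq_mul_div, div_le_iff₀ hrl] at h
  have hqsρ : q * θ.s * ρ ≤ |C| * (8 * (σx : ℝ) ^ 2) + 1 := by
    have h1 := hS.card_mul_rl_le hM hσx hl hlz hlu
    have h2 : q * θ.s * ρ * p ≤ |C| * (8 * (σx : ℝ) ^ 2) * p := by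
      calc q * θ.s * ρ * p = q * (θ.s * p * ρ) := by ring
        _ ≤ q * (|C| * θ.rl) := by gcongr
        _ = |C| * (q * θ.rl) := by ring
        _ ≤ |C| * (p * (8 * (σx : ℝ) ^ 2)) := by gcongr
        _ = _ := by ring
    linarith [le_of_mul_le_mul_right h2 hp0]
  obtain ⟨x₀, hx₀, hx₀l, hsx, hqsx, hbound⟩ :=
    hthr n p q θ.s hn hp2 hnp hs1 (hsa.trans (hn₀ n hsmall.1)) hqsρ
  -- The hypothesis `n ≤ C' p` turns `1 + p / n` into a multiple of `p / n`; then `(p / n) log 2 ≤ p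
  -- ρ² ≤ s p ρ · ρ ≤ |C| r_ℓ ρ`, using `p ≥ 2` and `s ≥ 1`.
  have hcoef : 34 / l + 40 / l * (p / n)
      ≤ (34 * |C'| + 40) / (l * Real.log 2) * (|C| + 1) * θ.rl * ρ := by
    have h1 : p / n * Real.log 2 ≤ (|C| + 1) * θ.rl * ρ := by
      calc p / n * Real.log 2 ≤ p / n * Real.log p := by gcongr
        _ = 1 * p * ρ * ρ := by rw [mul_assoc, ← sq, hρ2]; ring
        _ ≤ θ.s * p * ρ * ρ := by gcongr
        _ ≤ |C| * θ.rl * ρ := by gcongr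
        _ ≤ _ := by gcongr; linarith
    have h2 : 1 ≤ |C'| * (p / n) := by
      rw [← mul_div_assoc, one_le_div hn']
      exact hnp.trans (mul_le_mul_of_nonneg_right (le_abs_self _) hp0.le)
    calc 34 / l + 40 / l * (p / n) = 34 / l * 1 + 40 / l * (p / n) := by ring
      _ ≤ 34 / l * (|C'| * (p / n)) + 40 / l * (p / n) := by gcongr
      _ = (34 * |C'| + 40) / (l * Real.log 2) * (p / n * Real.log 2) := by field_simp
      _ ≤ (34 * |C'| + 40) / (l * Real.log 2) * ((|C| + 1) * θ.rl * ρ) := by gcongr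
      _ = _ := by ring
  refine le_trans ?_ (le_measureReal_goodEvent hn hM hS hV hcz hczle hl hlz hlu hlη hτ h8 hx₀
    hx₀l hε0.le hε hεl hsx hqsx hcoef)
  have hextra : 0 ≤ ((n₀ : ℝ) ^ m + 1) * ((n : ℝ) ^ (-(m : ℤ)) + (p : ℝ) ^ (-(m : ℤ))) := by
    positivity
  linarith
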